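/- Let $\mathbb{K}$ be a field of characteristic zero, $\Gamma$ a finitely generated abelian group and $\lambda:\Gamma\times\Gamma\to\mathbb{K}^\times$ a commutation factor, i.e. a biadditive map with $\lambda(x,y)\lambda(y,x)=1$. An element $x\in\Gamma$ is even if $\lambda(x,x)=1$ and odd if $\lambda(x,x)=-1$; this gives a parity morphism $\Gamma\to\mathbb{Z}/2$, $x\mapsto\bar x$, and $\Gamma=\Gamma_{\bar 0}\cup\Gamma_{\bar 1}$. Let $\mathcal{A}=\bigoplus_{\gamma\in\Gamma}\mathcal{A}^\gamma$ be a $(\Gamma,\lambda)$-commutative algebra: an associative unital $\Gamma$-graded $\mathbb{K}$-algebra with $ab=\lambda(\alpha,\beta)\,ba$ for $a\in\mathcal{A}^\alpha$, $b\in\mathcal{A}^\beta$. Let $\mathcal{A}_{\bar 0}=\bigoplus_{\gamma\in\Gamma_{\bar 0}}\mathcal{A}^\gamma$. Let $\mathfrak{S}(\lambda)$ be the set of biadditive maps $\varsigma:\Gamma\times\Gamma\to\mathbb{K}^\times$ with $\lambda(x,y)\varsigma(x,y)\varsigma(y,x)^{-1}=(-1)^{\bar x\bar y}$ for all $x,y$.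 For $\varsigma\in\mathfrak{S}(\lambda)$, let $\underline{\mathcal{A}}$ be the vector space $\mathcal{A}$ with the product given by $a\star b=\varsigma(\alpha,\beta)\,ab$ for $a\in\mathcal{A}^\alpha$, $b\in\mathcal{A}^\beta$; with the $\mathbb{Z}/2$-grading given by parity it is a supercommutative algebra. For $\boldsymbol\nu\in\Gamma^n$ and $x\in\Gamma$, let $\mathrm{Mat}^x(\boldsymbol\nu;\mathcal{A})$ be the space of $n\times n$ matrices $X$ over $\mathcal{A}$ with $X^i_{\;j}\in\mathcal{A}^{x-\nu_i+\nu_j}$, and let $\mathrm{GL}^x(\boldsymbol\nu;\mathcal{A})$ be the set of invertible matrices in it. Let $J_\varsigma$ be the linear map from $n\times n$ matrices over $\mathcal{A}$ to $n\times n$ matrices over $\underline{\mathcal{A}}$ given on $X\in\mathrm{Mat}^x(\boldsymbol\nu;\mathcal{A})$ by $$J_\varsigma(X)_{ij}=\varsigma(x,\nu_j)\,\varsigma(\nu_i,x-\nu_i+\nu_j)^{-1}X^i_{\;j}.$$ If all the $\nu_i$ have the same parity and $X\in\mathrm{Mat}^x(\boldsymbol\nu;\mathcal{A})$ with $x$ even,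 then $J_\varsigma(X)$ has entries in the commutative ring $\underline{\mathcal{A}}_{\bar 0}$, and $\mathrm{Gdet}_\varsigma(X):=\det(J_\varsigma(X))$. For an even invertible supermatrix $Y$ over $\underline{\mathcal{A}}$, i.e. $Y\in \mathrm{GL}(r_0|r_1;\underline{\mathcal{A}})$, let $\mathrm{ber}(Y)=\det(Y_{00}-Y_{01}Y_{11}^{-1}Y_{10})\star\det(Y_{11})^{-1}$ be its Berezinian, and let $\mathrm{Gber}_\varsigma:=\mathrm{ber}\circ J_\varsigma$. Let $r_0,r_1\in\mathbb{N}$ and $\boldsymbol\nu=(\boldsymbol\nu_0,\boldsymbol\nu_1)\in\Gamma_{\bar 0}^{r_0}\times\Gamma_{\bar 1}^{r_1}$. Then: 1. The maps $\mathrm{Gber}_\varsigma:\mathrm{GL}^0(\boldsymbol\nu;\mathcal{A})\to\mathcal{A}^\times$ do not depend on $\varsigma\in\mathfrak{S}(\lambda)$ and define a group morphism $\mathrm{Gber}^0:\mathrm{GL}^0(\boldsymbol\nu;\mathcal{A})\to\mathcal{A}^\times$. 2. For every $\varsigma\in\mathfrak{S}(\lambda)$, every even $x\in\Gamma_{\bar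 0}$ and every $X\in\mathrm{GL}^x(\boldsymbol\nu;\mathcal{A})$ with blocks $\mathcal{X}_{00},\mathcal{X}_{01},\mathcal{X}_{10},\mathcal{X}_{11}$ according to parity, $\mathrm{Gber}_\varsigma(X)$ is well defined: $J_\varsigma(X)\in\mathrm{GL}(r_0|r_1;\underline{\mathcal{A}})$, and $\mathrm{Gber}_\varsigma(X)\in(\mathcal{A}_{\bar 0})^\times$. Moreover $\mathcal{X}_{11}\in\mathrm{GL}^x(\boldsymbol\nu_1;\mathcal{A})$, $\mathcal{X}_{00}-\mathcal{X}_{01}\mathcal{X}_{11}^{-1}\mathcal{X}_{10}\in\mathrm{GL}^x(\boldsymbol\nu_0;\mathcal{A})$, $\mathrm{Gdet}_\varsigma(\mathcal{X}_{11})$ is invertible in $\mathcal{A}$, and $$\mathrm{Gber}_\varsigma(X)=\varsigma(x,x)^{-r_1(r_0-r_1)}\;\mathrm{Gdet}_\varsigma\big(\mathcal{X}_{00}-\mathcal{X}_{01}\mathcal{X}_{11}^{-1}\mathcal{X}_{10}\big)\cdot\mathrm{Gdet}_\varsigma(\mathcal{X}_{11})^{-1},$$ where the product and the inverses on the right-hand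 side are taken in $\mathcal{A}$ (and in matrices over $\mathcal{A}$). -/

import Mathlib

open scoped DirectSum

namespace Color

noncomputable section

universe u v w

/-! ### Commutation factors, parity, Nekludova-Scheunert multipliers -/

/-- A commutation factor `Γ × Γ → Kˣ` on the abelian group `Γ`. -/
structure CommutationFactor (Γ : Type u) (K : Type v) [AddCommGroup Γ] [Field K] where
  toFun : Γ → Γ → Kˣ
  mul_swap : ∀ x y, toFun x y * toFun y x = 1
  add_left : ∀ x y z, toFun (x + y) z = toFun x z * toFun y z
  add_right : ∀ x y z, toFun z (x + y) = toFun z x * toFun z y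

instance {Γ : Type u} {K : Type v} [AddCommGroup Γ] [Field K] :
    CoeFun (CommutationFactor Γ K) (fun _ => Γ → Γ → Kˣ) := ⟨CommutationFactor.toFun⟩

section Factor

variable {Γ : Type u} {K : Type v} [AddCommGroup Γ] [Field K]

theorem CommutationFactor.self_eq (lam : CommutationFactor Γ K) (x : Γ) :
    lam x x = 1 ∨ lam x x = -1 := by
  have h := lam.mul_swap x x
  have h2 : ((lam x x : Kˣ) : K) * ((lam x x : Kˣ) : K) = 1 := by
    rw [← Units.val_mul, h, Units.val_one]
  rcases mul_self_eq_one_iff.mp h2 with h3 | h3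
  · left
    exact Units.ext (by simpa using h3)
  · right
    exact Units.ext (by simpa using h3)

open Classical in
/-- The parity `Γ → ℤ/2` of a commutation factor: `x` is even if `lam x x = 1`, and odd if
`lam x x = -1`. -/
def CommutationFactor.parity (lam : CommutationFactor Γ K) : Γ →+ ZMod 2 where
  toFun x := if lam x x = 1 then 0 else 1
  map_zero' := by
    have h : lam 0 0 = 1 := by
      have h := lam.add_left 0 0 0
      rw [add_zero] at h
      exact (left_eq_mul.mp h)
    simp [h]
  map_add' x y := by
    have h : lam (x + y) (x + y) = lam x x * lam y y := by
      rw [lam.add_left, lam.add_right, lam.add_right]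
      calc lam x x * lam x y * (lam y x * lam y y)
          = lam x x * (lam x y * lam y x) * lam y y := by simp only [mul_assoc]
        _ = lam x x * lam y y := by rw [lam.mul_swap, mul_one]
    rcases lam.self_eq x with hx | hx <;> rcases lam.self_eq y with hy | hy <;>
      by_cases h1 : (-1 : Kˣ) = 1 <;> simp [h, hx, hy, h1]
    decide

/-- The sign rule `(-1)^(xy)` on `ℤ/2`. -/
def superSign (K : Type v) [Field K] (x y : ZMod 2) : Kˣ := (-1) ^ (x * y).val

/-- A Nekludova-Scheunert multiplier for `lam`: a biadditive map `s : Γ × Γ → Kˣ` such that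
`lam x y * s x y * (s y x)⁻¹ = (-1) ^ (parity x * parity y)`. The type of these is `𝔖(lam)`. -/
structure NSMultiplier (lam : CommutationFactor Γ K) where
  toFun : Γ → Γ → Kˣ
  add_left : ∀ x y z, toFun (x + y) z = toFun x z * toFun y z
  add_right : ∀ x y z, toFun z (x + y) = toFun z x * toFun z y
  twist : ∀ x y, lam x y * toFun x y * (toFun y x)⁻¹ =
    superSign K (lam.parity x) (lam.parity y)

instance (lam : CommutationFactor Γ K) :
    CoeFun (NSMultiplier lam) (fun _ => Γ → Γ → Kˣ) := ⟨NSMultiplier.toFun⟩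

theorem NSMultiplier.zero_left {lam : CommutationFactor Γ K} (s : NSMultiplier lam) (x : Γ) :
    s 0 x = 1 := by
  have h := s.add_left 0 0 x
  rw [add_zero] at h
  exact left_eq_mul.mp h

theorem NSMultiplier.zero_right {lam : CommutationFactor Γ K} (s : NSMultiplier lam) (x : Γ) :
    s x 0 = 1 := by
  have h := s.add_right 0 0 x
  rw [add_zero] at h
  exact left_eq_mul.mp h

end Factor

/-! ### Graded-commutative algebras -/

/-- A graded algebra is commutative for `f : Γ → Γ → Kˣ` if `a * b = f α β • (b * a)` for all
homogeneous `a`, `b` of degrees `α`, `β`. -/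
class IsColorCommutative {Γ : Type u} {K : Type v} {A : Type w} [Field K] [Ring A] [Algebra K A]
    (f : Γ → Γ → Kˣ) (𝒜 : Γ → Submodule K A) : Prop where
  mul_comm' : ∀ {α β : Γ} {a b : A}, a ∈ 𝒜 α → b ∈ 𝒜 β → a * b = f α β • (b * a)

/-- The change of grading along a map `φ` of index sets. -/
def regrade {Γ H : Type*} {K : Type v} {A : Type w} [Field K] [Ring A] [Algebra K A]
    (𝒜 : Γ → Submodule K A) (φ : Γ → H) (h : H) : Submodule K A :=
  ⨆ γ : {γ : Γ // φ γ = h}, 𝒜 γ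

section Regrade

variable {Γ H : Type*} {K : Type v} {A : Type w} [Field K] [Ring A] [Algebra K A]
  (𝒜 : Γ → Submodule K A)

theorem le_regrade (φ : Γ → H) (γ : Γ) : 𝒜 γ ≤ regrade 𝒜 φ (φ γ) :=
  le_iSup (fun γ' : {γ' : Γ // φ γ' = φ γ} => 𝒜 γ') ⟨γ, rfl⟩

theorem regrade_induction {φ : Γ → H} {h : H} {p : A → Prop}
    (mem : ∀ γ, φ γ = h → ∀ a ∈ 𝒜 γ, p a) (zero : p 0) (add : ∀ a b, p a → p b → p (a + b))
    {a : A} (ha : a ∈ regrade 𝒜 φ h) : p a :=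
  Submodule.iSup_induction (fun γ : {γ : Γ // φ γ = h} => 𝒜 γ) (motive := p) ha
    (fun γ a ha => mem γ γ.2 a ha) zero add

variable [AddCommGroup Γ] [AddCommGroup H] [DecidableEq Γ] [DecidableEq H] [GradedAlgebra 𝒜]

/-- The decomposition of elements of `A` along the new grading. -/
def regradeMap (φ : Γ →+ H) : A →ₗ[K] ⨁ h, regrade 𝒜 φ h :=
  (DirectSum.toModule K Γ (⨁ h, regrade 𝒜 φ h) (fun γ =>
    (DirectSum.lof K H (fun h => regrade 𝒜 φ h) (φ γ)).comp
      (Submodule.inclusion (le_regrade 𝒜 φ γ)))).comp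
    (DirectSum.decomposeLinearEquiv 𝒜).toLinearMap

theorem regradeMap_of_mem (φ : Γ →+ H) {h : H} (a : A) (ha : a ∈ regrade 𝒜 φ h) :
    regradeMap 𝒜 φ a = DirectSum.lof K H (fun h => regrade 𝒜 φ h) h ⟨a, ha⟩ := by
  have key : ∃ ha : a ∈ regrade 𝒜 φ h,
      regradeMap 𝒜 φ a = DirectSum.lof K H (fun h => regrade 𝒜 φ h) h ⟨a, ha⟩ := by
    refine regrade_induction 𝒜 (p := fun a => ∃ ha : a ∈ regrade 𝒜 φ h,
      regradeMap 𝒜 φ a = DirectSum.lof K H (fun h => regrade 𝒜 φ h) h ⟨a, ha⟩) ?_ ?_ ?_ ha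
    · intro γ hγ b hb
      subst hγ
      refine ⟨le_regrade 𝒜 φ γ hb, ?_⟩
      have h1 := DirectSum.decomposeLinearEquiv_apply_coe (R := K) 𝒜 γ ⟨b, hb⟩
      simp only [regradeMap, LinearMap.comp_apply, LinearEquiv.coe_coe, h1,
        DirectSum.toModule_lof]
      rfl
    · refine ⟨zero_mem _, ?_⟩
      rw [map_zero]
      exact (map_zero (DirectSum.lof K H (fun h => regrade 𝒜 φ h) h)).symm
    · rintro a b ⟨ha, ea⟩ ⟨hb, eb⟩
      refine ⟨add_mem ha hb, ?_⟩
      rw [map_add, ea, eb, ← map_add]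
      rfl
  exact key.2

/-- The regrading of a `Γ`-graded algebra along a morphism of groups `Γ → H` is an `H`-graded
algebra. -/
instance regrade.gradedAlgebra (φ : Γ →+ H) : GradedAlgebra (regrade 𝒜 φ) where
  one_mem := by
    have h := le_regrade 𝒜 φ 0 (SetLike.GradedOne.one_mem (A := 𝒜))
    rwa [map_zero] at h
  mul_mem i j a b ha hb := by
    refine regrade_induction 𝒜 (p := fun a => a * b ∈ regrade 𝒜 φ (i + j)) ?_ ?_ ?_ ha
    · intro α hα a ha
      refine regrade_induction 𝒜 (p := fun b => a * b ∈ regrade 𝒜 φ (i + j)) ?_ ?_ ?_ hb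
      · intro β hβ b hb
        have h := le_regrade 𝒜 φ (α + β) (SetLike.GradedMul.mul_mem ha hb)
        rwa [map_add, hα, hβ] at h
      · rw [mul_zero]
        exact zero_mem _
      · intro b c hb hc
        rw [mul_add]
        exact add_mem hb hc
    · rw [zero_mul]
      exact zero_mem _
    · intro b c hb hc
      rw [add_mul]
      exact add_mem hb hc
  toDecomposition := DirectSum.Decomposition.ofLinearMap (regrade 𝒜 φ) (regradeMap 𝒜 φ)
    (by
      refine DirectSum.decompose_lhom_ext 𝒜 (fun γ => ?_)
      ext a
      simp [regradeMap])
    (by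
      refine DirectSum.linearMap_ext _ (fun h => ?_)
      ext1 ⟨a, ha⟩
      simp [regradeMap_of_mem 𝒜 φ a ha])

end Regrade

/-! ### Change of commutation factor -/

section Rescale

variable {Γ : Type u} {K : Type v} {A : Type w} [AddCommGroup Γ] [DecidableEq Γ] [Field K]
  [Ring A] [Algebra K A] (𝒜 : Γ → Submodule K A) [GradedAlgebra 𝒜]

/-- The linear map multiplying the homogeneous elements of degree `γ` by `c γ`. -/
def rescale (c : Γ → Kˣ) : A →ₗ[K] A :=
  (DirectSum.toModule K Γ A (fun γ => (c γ : K) • (𝒜 γ).subtype)).comp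
    (DirectSum.decomposeLinearEquiv 𝒜).toLinearMap

theorem rescale_of_mem (c : Γ → Kˣ) {γ : Γ} {a : A} (ha : a ∈ 𝒜 γ) :
    rescale 𝒜 c a = c γ • a := by
  have h1 := DirectSum.decomposeLinearEquiv_apply_coe (R := K) 𝒜 γ ⟨a, ha⟩
  simp only [rescale, LinearMap.comp_apply, LinearEquiv.coe_coe, h1, DirectSum.toModule_lof]
  rfl

/-- The twisted product: the bilinear map with `a ⋆ b = s α β • (a * b)` for `a`, `b` homogeneous
of degrees `α`, `β`. -/
def starMul (s : Γ → Γ → Kˣ) : A →ₗ[K] A →ₗ[K] A :=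
  (DirectSum.toModule K Γ (A →ₗ[K] A) (fun α =>
    ((LinearMap.mul K A).compl₂ (rescale 𝒜 (s α))).comp (𝒜 α).subtype)).comp
    (DirectSum.decomposeLinearEquiv 𝒜).toLinearMap

theorem starMul_of_mem (s : Γ → Γ → Kˣ) {α β : Γ} {a b : A} (ha : a ∈ 𝒜 α) (hb : b ∈ 𝒜 β) :
    starMul 𝒜 s a b = s α β • (a * b) := by
  have h1 := DirectSum.decomposeLinearEquiv_apply_coe (R := K) 𝒜 α ⟨a, ha⟩
  simp only [starMul, LinearMap.comp_apply, LinearEquiv.coe_coe, h1, DirectSum.toModule_lof,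
    Submodule.subtype_apply, LinearMap.compl₂_apply, rescale_of_mem 𝒜 (s α) hb]
  exact mul_smul_comm _ _ _

/-- An additive property holds for all elements if it holds for the homogeneous ones. -/
theorem homogeneous_induction {p : A → Prop} (mem : ∀ γ, ∀ a ∈ 𝒜 γ, p a) (zero : p 0)
    (add : ∀ a b, p a → p b → p (a + b)) (a : A) : p a :=
  DirectSum.Decomposition.inductionOn 𝒜 zero (fun {γ} a => mem γ a a.2) add a

end Rescale

section Twist

variable {Γ : Type u} {K : Type v} {A : Type w} [AddCommGroup Γ] [Field K] [Ring A] [Algebra K A]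
  {lam : CommutationFactor Γ K}

/-- The underlying space of the algebra obtained from `A` by twisting its product by `s`. -/
def Twist (_𝒜 : Γ → Submodule K A) (_s : NSMultiplier lam) : Type w := A

variable (𝒜 : Γ → Submodule K A) (s : NSMultiplier lam)

instance : AddCommGroup (Twist 𝒜 s) := inferInstanceAs (AddCommGroup A)

instance : Module K (Twist 𝒜 s) := inferInstanceAs (Module K A)

/-- The identity map from `A` to its twist. -/
def toTwist : A ≃ₗ[K] Twist 𝒜 s := LinearEquiv.refl K A

variable [DecidableEq Γ] [GradedAlgebra 𝒜]

instance : Mul (Twist 𝒜 s) :=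
  ⟨fun a b => toTwist 𝒜 s (starMul 𝒜 s ((toTwist 𝒜 s).symm a) ((toTwist 𝒜 s).symm b))⟩

instance : One (Twist 𝒜 s) := ⟨toTwist 𝒜 s 1⟩

theorem toTwist_starMul (a b : A) :
    toTwist 𝒜 s (starMul 𝒜 s a b) = toTwist 𝒜 s a * toTwist 𝒜 s b := rfl

theorem starMul_assoc (a b c : A) :
    starMul 𝒜 s (starMul 𝒜 s a b) c = starMul 𝒜 s a (starMul 𝒜 s b c) := by
  refine homogeneous_induction 𝒜 (p := fun a => starMul 𝒜 s (starMul 𝒜 s a b) c =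
    starMul 𝒜 s a (starMul 𝒜 s b c)) (fun α a ha => ?_) (by simp)
    (fun a a' h h' => by simp [h, h']) a
  refine homogeneous_induction 𝒜 (p := fun b => starMul 𝒜 s (starMul 𝒜 s a b) c =
    starMul 𝒜 s a (starMul 𝒜 s b c)) (fun β b hb => ?_) (by simp)
    (fun a a' h h' => by simp [h, h']) b
  refine homogeneous_induction 𝒜 (p := fun c => starMul 𝒜 s (starMul 𝒜 s a b) c =
    starMul 𝒜 s a (starMul 𝒜 s b c)) (fun γ c hc => ?_) (by simp)
    (fun a a' h h' => by simp [h, h']) c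
  have hab : s α β • (a * b) ∈ 𝒜 (α + β) :=
    Submodule.smul_mem _ _ (SetLike.GradedMul.mul_mem ha hb)
  have hbc : s β γ • (b * c) ∈ 𝒜 (β + γ) :=
    Submodule.smul_mem _ _ (SetLike.GradedMul.mul_mem hb hc)
  rw [starMul_of_mem 𝒜 s ha hb, starMul_of_mem 𝒜 s hb hc, starMul_of_mem 𝒜 s hab hc,
    starMul_of_mem 𝒜 s ha hbc, smul_mul_assoc, mul_smul_comm, smul_smul, smul_smul, mul_assoc,
    s.add_left, s.add_right]
  congr 1
  rw [mul_right_comm, mul_comm (s α γ)]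

theorem one_starMul (a : A) : starMul 𝒜 s 1 a = a := by
  refine homogeneous_induction 𝒜 (p := fun a => starMul 𝒜 s 1 a = a) (fun α a ha => ?_) (by simp)
    (fun a a' h h' => by simp [h, h']) a
  rw [starMul_of_mem 𝒜 s (SetLike.GradedOne.one_mem (A := 𝒜)) ha, s.zero_left, one_smul, one_mul]

theorem starMul_one (a : A) : starMul 𝒜 s a 1 = a := by
  refine homogeneous_induction 𝒜 (p := fun a => starMul 𝒜 s a 1 = a) (fun α a ha => ?_) (by simp)
    (fun a a' h h' => by simp [h, h']) a
  rw [starMul_of_mem 𝒜 s ha (SetLike.GradedOne.one_mem (A := 𝒜)), s.zero_right, one_smul, mul_one]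

instance : Ring (Twist 𝒜 s) :=
  { (inferInstance : AddCommGroup (Twist 𝒜 s)),
    (inferInstance : Mul (Twist 𝒜 s)), (inferInstance : One (Twist 𝒜 s)) with
    left_distrib := fun a b c => map_add (starMul 𝒜 s a) b c
    right_distrib := fun a b c => LinearMap.map_add₂ (starMul 𝒜 s) a b c
    zero_mul := fun a => LinearMap.map_zero₂ (starMul 𝒜 s) a
    mul_zero := fun a => map_zero (starMul 𝒜 s a)
    mul_assoc := fun a b c => starMul_assoc 𝒜 s a b c
    one_mul := fun a => one_starMul 𝒜 s a
    mul_one := fun a => starMul_one 𝒜 s a }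

instance : Algebra K (Twist 𝒜 s) :=
  Algebra.ofModule (fun r a b => LinearMap.map_smul₂ (starMul 𝒜 s) r a b)
    (fun r a b => map_smul (starMul 𝒜 s a) r b)

/-- The `Γ`-grading of the twisted algebra: it is the one of `A`. -/
def Twist.grading (γ : Γ) : Submodule K (Twist 𝒜 s) := (𝒜 γ).map (toTwist 𝒜 s).toLinearMap

theorem toTwist_mem {γ : Γ} {a : A} (ha : a ∈ 𝒜 γ) : toTwist 𝒜 s a ∈ Twist.grading 𝒜 s γ :=
  Submodule.mem_map_of_mem ha

instance Twist.gradedAlgebra : GradedAlgebra (Twist.grading 𝒜 s) where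
  one_mem := toTwist_mem 𝒜 s (SetLike.GradedOne.one_mem (A := 𝒜))
  mul_mem := by
    rintro α β _ _ ⟨a, ha, rfl⟩ ⟨b, hb, rfl⟩
    have h := toTwist_mem 𝒜 s
      (Submodule.smul_mem _ (s α β : K) (SetLike.GradedMul.mul_mem ha hb))
    have e := starMul_of_mem 𝒜 s ha hb
    change toTwist 𝒜 s (starMul 𝒜 s a b) ∈ _
    rw [e]
    exact h
  toDecomposition := DirectSum.Decomposition.ofLinearMap (Twist.grading 𝒜 s)
    ((DirectSum.toModule K Γ (⨁ γ, Twist.grading 𝒜 s γ) (fun γ =>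
      (DirectSum.lof K Γ (fun γ => Twist.grading 𝒜 s γ) γ).comp
        ((toTwist 𝒜 s).submoduleMap (𝒜 γ)).toLinearMap)).comp
      ((DirectSum.decomposeLinearEquiv 𝒜).toLinearMap.comp (toTwist 𝒜 s).symm.toLinearMap))
    (by
      refine (LinearMap.cancel_right (toTwist 𝒜 s).surjective).mp ?_
      refine DirectSum.decompose_lhom_ext 𝒜 (fun γ => ?_)
      refine LinearMap.ext (fun a => ?_)
      simp only [LinearMap.comp_apply, LinearEquiv.coe_coe, Submodule.subtype_apply,
        LinearEquiv.symm_apply_apply, DirectSum.decomposeLinearEquiv_apply_coe,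
        DirectSum.toModule_lof, LinearMap.id_apply]
      exact DirectSum.coeLinearMap_lof (R := K) (Twist.grading 𝒜 s) γ ((toTwist 𝒜 s).submoduleMap (𝒜 γ) a))
    (by
      refine DirectSum.linearMap_ext _ (fun γ => ?_)
      ext1 ⟨_, a, ha, rfl⟩
      have h1 := DirectSum.decomposeLinearEquiv_apply_coe (R := K) 𝒜 γ ⟨a, ha⟩
      simp at h1
      simp [h1]
      rfl)

/-- The `ℤ/2`-grading of the twisted algebra, given by the parity. -/
def Twist.superGrading : ZMod 2 → Submodule K (Twist 𝒜 s) :=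
  regrade (Twist.grading 𝒜 s) lam.parity

instance Twist.superGradedAlgebra : GradedAlgebra (Twist.superGrading 𝒜 s) :=
  regrade.gradedAlgebra (Twist.grading 𝒜 s) lam.parity

/-- The twisted algebra is supercommutative. -/
instance Twist.superCommutative [IsColorCommutative lam 𝒜] :
    IsColorCommutative (superSign K) (Twist.superGrading 𝒜 s) where
  mul_comm' := by
    intro i j a b ha hb
    refine regrade_induction (Twist.grading 𝒜 s)
      (p := fun a => a * b = superSign K i j • (b * a)) ?_ ?_ ?_ ha
    · intro α hα a ha
      refine regrade_induction (Twist.grading 𝒜 s)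
        (p := fun b => a * b = superSign K i j • (b * a)) ?_ ?_ ?_ hb
      · rintro β hβ _ ⟨b, hb, rfl⟩
        obtain ⟨a, ha, rfl⟩ := ha
        have e1 := starMul_of_mem 𝒜 s ha hb
        have e2 := starMul_of_mem 𝒜 s hb ha
        have key : starMul 𝒜 s a b = superSign K i j • starMul 𝒜 s b a := by
          rw [e1, e2, ← hα, ← hβ, ← s.twist, IsColorCommutative.mul_comm' (f := lam) ha hb,
            smul_smul, smul_smul, inv_mul_cancel_right, mul_comm]
        exact key
      · rw [mul_zero, zero_mul, smul_zero]
      · intro b c hb hc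
        rw [mul_add, add_mul, smul_add, hb, hc]
    · rw [mul_zero, zero_mul, smul_zero]
    · intro b c hb hc
      rw [mul_add, add_mul, smul_add, hb, hc]

end Twist

/-! ### Graded matrices -/

section GradedMatrix

variable {Γ : Type*} {K : Type v} {A : Type w} [AddCommGroup Γ] [Field K] [Ring A] [Algebra K A]
  (𝒜 : Γ → Submodule K A) {n : Type*} [Fintype n] [DecidableEq n]

/-- `X ∈ Mat^γ(ν; A)`: the entry `X i j` is homogeneous of degree `γ - ν i + ν j`. -/
def MemMat (ν : n → Γ) (γ : Γ) (X : Matrix n n A) : Prop :=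
  ∀ i j, X i j ∈ 𝒜 (γ - ν i + ν j)

/-- `X ∈ GL^γ(ν; A)`: the matrix `X` is invertible and homogeneous of degree `γ`. -/
def MemGL (ν : n → Γ) (γ : Γ) (X : Matrix n n A) : Prop :=
  IsUnit X ∧ MemMat 𝒜 ν γ X

variable [DecidableEq Γ] [GradedAlgebra 𝒜]

theorem memMat_inv (ν : n → Γ) (X Y : Matrix n n A) (hX : MemMat 𝒜 ν 0 X) (h1 : X * Y = 1)
    (h2 : Y * X = 1) : MemMat 𝒜 ν 0 Y := by
  let P : Matrix n n A := Matrix.of fun i j => (DirectSum.decompose 𝒜 (Y i j) (0 - ν i + ν j) : A)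
  have hP : X * P = 1 := by
    ext i j
    have e : (X * Y) i j = (1 : Matrix n n A) i j := by rw [h1]
    have e2 := congrArg (GradedAlgebra.proj 𝒜 (0 - ν i + ν j)) e
    rw [Matrix.mul_apply, map_sum] at e2
    simp only [GradedAlgebra.proj_apply] at e2
    have e3 : ∀ k, (DirectSum.decompose 𝒜 (X i k * Y k j) (0 - ν i + ν j) : A) = X i k * P k j := by
      intro k
      have h := DirectSum.coe_decompose_mul_add_of_left_mem (j := 0 - ν k + ν j) 𝒜 (b := Y k j)
        (hX i k)
      rwa [show 0 - ν i + ν k + (0 - ν k + ν j) = 0 - ν i + ν j by abel] at h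
    simp only [e3] at e2
    rw [Matrix.mul_apply, e2]
    by_cases hij : i = j
    · subst hij
      rw [Matrix.one_apply_eq, show (0 : Γ) - ν i + ν i = 0 by abel]
      exact DirectSum.decompose_of_mem_same 𝒜 (SetLike.GradedOne.one_mem (A := 𝒜))
    · rw [Matrix.one_apply_ne hij, DirectSum.decompose_zero]
      rfl
  have hYP : Y = P := by
    calc Y = Y * (X * P) := by rw [hP, mul_one]
      _ = P := by rw [← mul_assoc, h2, one_mul]
  intro i j
  rw [hYP]
  exact (DirectSum.decompose 𝒜 (Y i j) (0 - ν i + ν j)).2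

/-- The group `GL^0(ν; A)`. -/
def GLZero (ν : n → Γ) : Subgroup (Matrix n n A)ˣ where
  carrier := {X | MemMat 𝒜 ν 0 (X : Matrix n n A)}
  one_mem' := by
    intro i j
    by_cases hij : i = j
    · subst hij
      rw [Units.val_one, Matrix.one_apply_eq, show (0 : Γ) - ν i + ν i = 0 by abel]
      exact SetLike.GradedOne.one_mem (A := 𝒜)
    · rw [Units.val_one, Matrix.one_apply_ne hij]
      exact zero_mem _
  mul_mem' := by
    intro X Y hX hY i j
    rw [Units.val_mul, Matrix.mul_apply]
    refine sum_mem (fun k _ => ?_)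
    have h := SetLike.GradedMul.mul_mem (hX i k) (hY k j)
    rwa [show 0 - ν i + ν k + (0 - ν k + ν j) = 0 - ν i + ν j by abel] at h
  inv_mem' := by
    intro X hX
    exact memMat_inv 𝒜 ν X.val X.inv hX X.val_inv X.inv_val

end GradedMatrix

/-! ### The Berezinian over a supercommutative algebra -/

section Berezinian

variable {K : Type v} {R : Type w} [Field K] [Ring R] [Algebra K R]
  (𝓡 : ZMod 2 → Submodule K R) [GradedAlgebra 𝓡] [IsColorCommutative (superSign K) 𝓡]
  {m n : Type*} [Fintype m] [DecidableEq m] [Fintype n] [DecidableEq n]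

/-- The even part of a supercommutative algebra is a commutative ring. -/
@[reducible]
def evenCommRing : CommRing (𝓡 0) :=
  { (inferInstance : Ring (𝓡 0)) with
    mul_comm := by
      intro a b
      have h := IsColorCommutative.mul_comm' (f := superSign K) a.2 b.2
      have e : superSign K 0 0 = 1 := by simp [superSign]
      rw [e, one_smul] at h
      exact Subtype.ext h }

open Classical in
/-- The determinant of a matrix whose entries lie in the even part `𝓡 0` (and `0` for other
matrices). -/
def evenDet (M : Matrix n n R) : 𝓡 0 :=
  letI := evenCommRing 𝓡
  if h : ∀ i j, M i j ∈ 𝓡 0 then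
    Matrix.det (Matrix.of fun i j => (⟨M i j, h i j⟩ : 𝓡 0))
  else 0

/-- The parities of the rows and columns of supermatrices. -/
def superDegree : m ⊕ n → ZMod 2 := Sum.elim (fun _ => 0) (fun _ => 1)

/-- `Y ∈ GL(p|q; R)`: `Y` is an even invertible supermatrix, i.e. `Y` is invertible, its diagonal
blocks have even entries and its off-diagonal blocks have odd entries. -/
def MemSuperGL (Y : Matrix (m ⊕ n) (m ⊕ n) R) : Prop :=
  MemGL 𝓡 superDegree 0 Y

/-- The Berezinian `det (Y₀₀ - Y₀₁ Y₁₁⁻¹ Y₁₀) (det Y₁₁)⁻¹` of an even invertible supermatrix. -/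
def ber (Y : Matrix (m ⊕ n) (m ⊕ n) R) : 𝓡 0 :=
  evenDet 𝓡 (Y.toBlocks₁₁ - Y.toBlocks₁₂ * Ring.inverse Y.toBlocks₂₂ * Y.toBlocks₂₁) *
    Ring.inverse (evenDet 𝓡 Y.toBlocks₂₂)

end Berezinian

/-! ### The maps `J`, graded determinants and graded Berezinians -/

section Graded

variable {Γ : Type u} {K : Type v} {A : Type w} [AddCommGroup Γ] [DecidableEq Γ] [Field K]
  [Ring A] [Algebra K A] {lam : CommutationFactor Γ K} (𝒜 : Γ → Submodule K A) [GradedAlgebra 𝒜]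
  (s : NSMultiplier lam) {m n : Type*}

/-- The linear map `J` from `Mat(ν; A)` to matrices over the twisted algebra, which multiplies the
entry `X i j` of a homogeneous matrix `X` of degree `x` by `s x (ν j) * (s (ν i) (x - ν i + ν j))⁻¹`
(see `gradedJ_apply`). A component of degree `γ` of an entry `X i j` belongs to the homogeneous
component of degree `x = γ + ν i - ν j` of the matrix `X`. -/
def gradedJ (ν : n → Γ) (X : Matrix n n A) : Matrix n n (Twist 𝒜 s) :=
  Matrix.of fun i j => toTwist 𝒜 s
    (rescale 𝒜 (fun γ => s (γ + ν i - ν j) (ν j) * (s (ν i) γ)⁻¹) (X i j))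

theorem gradedJ_apply (ν : n → Γ) (x : Γ) (X : Matrix n n A) (hX : MemMat 𝒜 ν x X) (i j : n) :
    gradedJ 𝒜 s ν X i j =
      toTwist 𝒜 s ((s x (ν j) * (s (ν i) (x - ν i + ν j))⁻¹) • X i j) := by
  simp only [gradedJ, Matrix.of_apply]
  rw [rescale_of_mem 𝒜 _ (hX i j), show x - ν i + ν j + ν i - ν j = x by abel]

variable [IsColorCommutative lam 𝒜] [Fintype m] [DecidableEq m] [Fintype n] [DecidableEq n]

/-- The graded determinant `det ∘ J`, for matrices such that the entries of `J X` are even (for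
instance homogeneous matrices of even degree when all `ν i` have the same parity). -/
def gdet (ν : n → Γ) (X : Matrix n n A) : A :=
  (toTwist 𝒜 s).symm (evenDet (Twist.superGrading 𝒜 s) (gradedJ 𝒜 s ν X) : Twist 𝒜 s)

/-- The graded Berezinian `ber ∘ J`. -/
def gber (ν₀ : m → Γ) (ν₁ : n → Γ) (X : Matrix (m ⊕ n) (m ⊕ n) A) : A :=
  (toTwist 𝒜 s).symm
    (ber (Twist.superGrading 𝒜 s) (gradedJ 𝒜 s (Sum.elim ν₀ ν₁) X) : Twist 𝒜 s)

end Graded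

end

end Color

open Color

namespace Color

noncomputable section

universe u v w

set_option linter.unusedSectionVars false

/-! ### Determinants of matrices over the even part of a supercommutative algebra. -/

section EvenDet

variable {K : Type v} {R : Type w} [Field K] [Ring R] [Algebra K R]
  (𝓡 : ZMod 2 → Submodule K R) [GradedAlgebra 𝓡] [IsColorCommutative (superSign K) 𝓡]
  {m n : Type*} [Fintype m] [DecidableEq m] [Fintype n] [DecidableEq n]

/-! Subscripts 0 and 1 on blocks below denote parities, and ς a multiplier. The maps J satisfy J(X)
J(Y) = ς(x,y) J(XY) for X, Y of degrees x, y (`rectJ_mul`). In degree 0 they are therefore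
multiplicative, and the twisted product of elements of degree 0 is the ordinary one, so Gber
inherits multiplicativity from the classical Berezinian.

In an arbitrary even degree x, J preserves and reflects invertibility and commutes with Schur
complements (`schur_gradedJ`). Hence Gber(X) is a twisted quotient of two graded determinants,
homogeneous of degrees r₀x and r₁x. Rewriting the twisted product and the twisted inverse in the
original algebra produces the factor ς(x,x)^(r₁² - r₀r₁) (`gber_eq`).

The classical Berezinian is multiplicative because the inverse of the Schur complement of Y is the
block (Y⁻¹)₀₀, so that ber(Y)⁻¹ = det(Y₁₁) det((Y⁻¹)₀₀). For a product, these two blocks differ from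
the products of the corresponding blocks by factors 1 + CB and 1 + BC with B, C odd, and the
determinants of these factors cancel (`evenDet_one_add_mul_comm`).

For independence of ς, two multipliers differ by a symmetric biadditive form. In degree 0 this form
changes the coefficient of each permutation in the Leibniz formula by a factor that an identity for
symmetric forms (`sum_Ioi_symm_form`) shows to be 1. A multiplier exists because an alternating form
on a finitely generated group has the shape C(x,y) - C(y,x) (`exists_alternation`). -/

theorem mul_mem_even {i : ZMod 2} {a b : R} (ha : a ∈ 𝓡 i) (hb : b ∈ 𝓡 i) : a * b ∈ 𝓡 0 := by
  have h := SetLike.GradedMul.mul_mem ha hb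
  rwa [CharTwo.add_self_eq_zero] at h

theorem odd_mul_swap {a b : R} (ha : a ∈ 𝓡 1) (hb : b ∈ 𝓡 1) : a * b = -(b * a) := by
  have h := IsColorCommutative.mul_comm' (f := superSign K) ha hb
  have e : superSign K 1 1 = -1 := by simp [superSign, ZMod.val_one]
  rw [h, e, Units.smul_def]
  simp

/-- Characteristic zero enters here: anticommutation alone only gives that twice the square
vanishes. -/
theorem odd_mul_self [CharZero K] {a : R} (ha : a ∈ 𝓡 1) : a * a = 0 := by
  have h := odd_mul_swap 𝓡 ha ha
  have h2 : (2 : K) • (a * a) = 0 := by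
    rw [two_smul]
    exact eq_neg_iff_add_eq_zero.mp h
  exact (smul_eq_zero.mp h2).resolve_left two_ne_zero

theorem odd_mul_sq [CharZero K] {a b : R} (ha : a ∈ 𝓡 1) (hb : b ∈ 𝓡 1) :
    (a * b) * (a * b) = 0 := by
  rw [mul_assoc, ← mul_assoc b, odd_mul_swap 𝓡 hb ha, neg_mul, mul_neg, mul_assoc,
    odd_mul_self 𝓡 hb, mul_zero, mul_zero, neg_zero]

/-- The coercion of matrices over the even part. -/
def evenMap (N : Matrix m n (𝓡 0)) : Matrix m n R := Matrix.of fun i j => (N i j : R)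

theorem exists_evenMap {M : Matrix m n R} (h : ∀ i j, M i j ∈ 𝓡 0) : ∃ N, evenMap 𝓡 N = M :=
  ⟨Matrix.of fun i j => ⟨M i j, h i j⟩, rfl⟩

theorem evenMap_mem (N : Matrix m n (𝓡 0)) (i : m) (j : n) : evenMap 𝓡 N i j ∈ 𝓡 0 := (N i j).2

theorem evenMap_mul (M N : Matrix n n (𝓡 0)) :
    letI := evenCommRing 𝓡
    evenMap 𝓡 (M * N) = evenMap 𝓡 M * evenMap 𝓡 N := by
  ext i j
  simp only [evenMap, Matrix.mul_apply, Matrix.of_apply]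
  exact map_sum (𝓡 0).subtype _ _

theorem evenMap_one :
    letI := evenCommRing 𝓡
    evenMap 𝓡 (1 : Matrix n n (𝓡 0)) = 1 := by
  ext i j
  by_cases h : i = j
  · subst h
    simp only [evenMap, Matrix.of_apply, Matrix.one_apply_eq]
    rfl
  · simp only [evenMap, Matrix.of_apply, Matrix.one_apply_ne h]
    rfl

theorem evenDet_evenMap (N : Matrix n n (𝓡 0)) :
    letI := evenCommRing 𝓡
    evenDet 𝓡 (evenMap 𝓡 N) = N.det := by
  unfold evenDet
  rw [dif_pos (evenMap_mem 𝓡 N)]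
  rfl

theorem evenDet_one : evenDet 𝓡 (1 : Matrix n n R) = 1 := by
  let _ := evenCommRing 𝓡
  rw [← evenMap_one 𝓡, evenDet_evenMap]
  exact Matrix.det_one

theorem evenDet_mul {M N : Matrix n n R} (hM : ∀ i j, M i j ∈ 𝓡 0) (hN : ∀ i j, N i j ∈ 𝓡 0) :
    evenDet 𝓡 (M * N) = evenDet 𝓡 M * evenDet 𝓡 N := by
  let _ := evenCommRing 𝓡
  obtain ⟨M, rfl⟩ := exists_evenMap 𝓡 hM
  obtain ⟨N, rfl⟩ := exists_evenMap 𝓡 hN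
  rw [← evenMap_mul, evenDet_evenMap, evenDet_evenMap, evenDet_evenMap]
  exact Matrix.det_mul M N

theorem isUnit_of_isUnit_evenDet {M : Matrix n n R} (hM : ∀ i j, M i j ∈ 𝓡 0)
    (h : IsUnit (evenDet 𝓡 M)) : IsUnit M := by
  let _ := evenCommRing 𝓡
  obtain ⟨M, rfl⟩ := exists_evenMap 𝓡 hM
  rw [evenDet_evenMap] at h
  refine ⟨⟨evenMap 𝓡 M, evenMap 𝓡 M⁻¹, ?_, ?_⟩, rfl⟩
  · rw [← evenMap_mul 𝓡, ← evenMap_one 𝓡, Matrix.mul_nonsing_inv _ h]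
  · rw [← evenMap_mul 𝓡, ← evenMap_one 𝓡, Matrix.nonsing_inv_mul _ h]

theorem inverse_mem_even {M : Matrix n n R} (hM : ∀ i j, M i j ∈ 𝓡 0) (h : IsUnit M) (i j : n) :
    Ring.inverse M i j ∈ 𝓡 0 := by
  have h1 := memMat_inv 𝓡 (fun _ : n => 0) M (Ring.inverse M)
    (fun i j => by simpa using hM i j) (Ring.mul_inverse_cancel _ h) (Ring.inverse_mul_cancel _ h)
  simpa using h1 i j

theorem evenDet_mul_inverse {M : Matrix n n R} (hM : ∀ i j, M i j ∈ 𝓡 0) (h : IsUnit M) :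
    evenDet 𝓡 M * evenDet 𝓡 (Ring.inverse M) = 1 := by
  rw [← evenDet_mul 𝓡 hM (inverse_mem_even 𝓡 hM h), Ring.mul_inverse_cancel _ h, evenDet_one]

theorem isUnit_evenDet {M : Matrix n n R} (hM : ∀ i j, M i j ∈ 𝓡 0) (h : IsUnit M) :
    IsUnit (evenDet 𝓡 M) := by
  let _ := evenCommRing 𝓡
  exact IsUnit.of_mul_eq_one _ (evenDet_mul_inverse 𝓡 hM h)

theorem mul_mem_even_of_odd {B : Matrix m n R} {C : Matrix n m R} (hB : ∀ i j, B i j ∈ 𝓡 1)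
    (hC : ∀ i j, C i j ∈ 𝓡 1) (i j : m) : (B * C) i j ∈ 𝓡 0 := by
  rw [Matrix.mul_apply]
  exact sum_mem fun k _ => mul_mem_even 𝓡 (hB i k) (hC k j)

theorem one_mem_even (i j : n) : (1 : Matrix n n R) i j ∈ 𝓡 0 := by
  by_cases h : i = j
  · subst h
    rw [Matrix.one_apply_eq]
    exact SetLike.GradedOne.one_mem
  · rw [Matrix.one_apply_ne h]
    exact zero_mem _

theorem one_add_mul_mem_even {B : Matrix m n R} {C : Matrix n m R} (hB : ∀ i j, B i j ∈ 𝓡 1)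
    (hC : ∀ i j, C i j ∈ 𝓡 1) (i j : m) : (1 + B * C : Matrix m m R) i j ∈ 𝓡 0 :=
  add_mem (one_mem_even 𝓡 i j) (mul_mem_even_of_odd 𝓡 hB hC i j)

/-- Each entry of B C is a sum of products of two odd elements, which are nilpotent in the
commutative even part. Modulo the nilradical the matrix becomes the identity, so its determinant is
1 plus a nilpotent. -/
theorem isUnit_evenDet_one_add [CharZero K] {B : Matrix m n R} {C : Matrix n m R}
    (hB : ∀ i j, B i j ∈ 𝓡 1) (hC : ∀ i j, C i j ∈ 𝓡 1) : IsUnit (evenDet 𝓡 (1 + B * C)) := by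
  let _ := evenCommRing 𝓡
  obtain ⟨N, hN⟩ := exists_evenMap 𝓡 (mul_mem_even_of_odd 𝓡 hB hC)
  have e : 1 + B * C = evenMap 𝓡 (1 + N) := by
    rw [← hN, ← evenMap_one 𝓡]
    rfl
  rw [e, evenDet_evenMap]
  have nil : ∀ i j, N i j ∈ nilradical (𝓡 0) := by
    intro i j
    have h : N i j = ∑ k, (⟨B i k * C k j, mul_mem_even 𝓡 (hB i k) (hC k j)⟩ : 𝓡 0) := by
      refine Subtype.ext ?_
      have h1 := congrFun (congrFun hN i) j
      rw [Matrix.mul_apply] at h1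
      exact h1.trans (map_sum (𝓡 0).subtype
        (fun k => (⟨B i k * C k j, mul_mem_even 𝓡 (hB i k) (hC k j)⟩ : 𝓡 0)) _).symm
    rw [h]
    -- A product of two odd elements has square zero, hence the exponent 2.
    refine sum_mem fun k _ => ⟨2, ?_⟩
    rw [pow_two]
    exact Subtype.ext (odd_mul_sq 𝓡 (hB i k) (hC k j))
  have h1 : Ideal.Quotient.mk (nilradical (𝓡 0)) (1 + N).det = 1 := by
    have h0 : (Ideal.Quotient.mk (nilradical (𝓡 0))).mapMatrix N = 0 := by
      ext i j
      exact Ideal.Quotient.eq_zero_iff_mem.mpr (nil i j)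
    rw [RingHom.map_det, map_add, map_one, h0, add_zero, Matrix.det_one]
  rw [← map_one (Ideal.Quotient.mk (nilradical (𝓡 0))), Ideal.Quotient.eq] at h1
  have h2 : IsNilpotent ((1 + N).det - 1) := h1
  simpa using h2.isUnit_one_add

/-- The product with a single-entry matrix has only its column j nonzero, so it is a column times a
row of rank one and det(1 + u v) = 1 + v u applies. -/
theorem evenDet_one_add_single {B : Matrix m n R} (hB : ∀ i j, B i j ∈ 𝓡 1) {c : R}
    (hc : c ∈ 𝓡 1) (i : n) (j : m) :
    (evenDet 𝓡 (1 + B * Matrix.single i j c) : R) = 1 + B j i * c := by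
  let _ := evenCommRing 𝓡
  let a : m → 𝓡 0 := fun k => ⟨B k i * c, mul_mem_even 𝓡 (hB k i) hc⟩
  have e : 1 + B * Matrix.single i j c = evenMap 𝓡
      (1 + Matrix.replicateCol Unit a * Matrix.replicateRow Unit (Pi.single j (1 : 𝓡 0))) := by
    ext k l
    have h : evenMap 𝓡 (1 + Matrix.replicateCol Unit a *
        Matrix.replicateRow Unit (Pi.single j (1 : 𝓡 0))) k l =
        evenMap 𝓡 (1 : Matrix m m (𝓡 0)) k l +
          ((a k * Pi.single (M := fun _ => 𝓡 0) j (1 : 𝓡 0) l : 𝓡 0) : R) := by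
      simp only [evenMap, Matrix.mul_apply, Matrix.of_apply, Matrix.add_apply]
      simp
    rw [h, evenMap_one, Matrix.add_apply]
    congr 1
    by_cases hl : l = j
    · subst hl
      rw [Matrix.mul_single_apply_same, Pi.single_eq_same, mul_one]
    · rw [Matrix.mul_single_apply_of_ne _ _ _ _ _ hl, Pi.single_eq_of_ne hl, mul_zero]
      rfl
  rw [e, evenDet_evenMap, Matrix.det_one_add_replicateCol_mul_replicateRow, single_dotProduct,
    one_mul]
  rfl

theorem evenDet_one_add_single_mul {B : Matrix m n R} (hB : ∀ i j, B i j ∈ 𝓡 1) {c : R}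
    (hc : c ∈ 𝓡 1) (i : n) (j : m) :
    (evenDet 𝓡 (1 + Matrix.single i j c * B) : R) = 1 + c * B j i := by
  let _ := evenCommRing 𝓡
  let a : n → 𝓡 0 := fun k => ⟨c * B j k, mul_mem_even 𝓡 hc (hB j k)⟩
  have e : 1 + Matrix.single i j c * B = evenMap 𝓡
      (1 + Matrix.replicateCol Unit (Pi.single i (1 : 𝓡 0)) * Matrix.replicateRow Unit a) := by
    ext k l
    have h : evenMap 𝓡 (1 + Matrix.replicateCol Unit (Pi.single i (1 : 𝓡 0)) *
        Matrix.replicateRow Unit a) k l =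
        evenMap 𝓡 (1 : Matrix n n (𝓡 0)) k l +
          ((Pi.single (M := fun _ => 𝓡 0) i (1 : 𝓡 0) k * a l : 𝓡 0) : R) := by
      simp only [evenMap, Matrix.mul_apply, Matrix.of_apply, Matrix.add_apply]
      simp
    rw [h, evenMap_one, Matrix.add_apply]
    congr 1
    by_cases hl : k = i
    · subst hl
      rw [Matrix.single_mul_apply_same, Pi.single_eq_same, one_mul]
    · rw [Matrix.single_mul_apply_of_ne _ _ _ _ _ hl, Pi.single_eq_of_ne hl, zero_mul]
      rfl
  rw [e, evenDet_evenMap, Matrix.det_one_add_replicateCol_mul_replicateRow, dotProduct_single,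
    mul_one]
  rfl

end EvenDet

/-! ### Schur complements and blocks of the inverse matrix, over any ring. -/

section Schur

theorem inverse_mul_of_isUnit {M : Type*} [MonoidWithZero M] {a b : M} (ha : IsUnit a)
    (hb : IsUnit b) : Ring.inverse (a * b) = Ring.inverse b * Ring.inverse a := by
  obtain ⟨u, rfl⟩ := ha
  obtain ⟨v, rfl⟩ := hb
  rw [← Units.val_mul, Ring.inverse_unit, Ring.inverse_unit, Ring.inverse_unit, mul_inv_rev,
    Units.val_mul]

/-- Bookkeeping for the multiplicativity of the Berezinian: a, b, c stand for the Berezinians of Y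
Z, Y, Z, and p, q for the determinants of 1 + B C and 1 + C B, which cancel. -/
theorem eq_mul_of_mul_eq_one {M : Type*} [CommMonoid M] {a b c b₁ b₂ c₁ c₂ p q : M}
    (h : a * (b₁ * q * c₁ * (c₂ * p * b₂)) = 1) (hb : b * (b₁ * b₂) = 1)
    (hc : c * (c₁ * c₂) = 1) (hp : p * q = 1) : a = b * c := by
  calc a = a * (b * (b₁ * b₂)) * (c * (c₁ * c₂)) * (p * q) := by rw [hb, hc, hp]; simp
    _ = a * (b₁ * q * c₁ * (c₂ * p * b₂)) * (b * c) := by ac_rfl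
    _ = b * c := by rw [h, one_mul]

variable {R : Type w} [Ring R] {m n : Type*} [Fintype m] [DecidableEq m] [Fintype n]
  [DecidableEq n]

theorem toBlocks₁₁_mul (Y Z : Matrix (m ⊕ n) (m ⊕ n) R) : (Y * Z).toBlocks₁₁ =
    Y.toBlocks₁₁ * Z.toBlocks₁₁ + Y.toBlocks₁₂ * Z.toBlocks₂₁ := by
  ext i j
  simp [Matrix.toBlocks₁₁, Matrix.toBlocks₁₂, Matrix.toBlocks₂₁, Matrix.mul_apply,
    Fintype.sum_sum_type]

theorem toBlocks₁₂_mul (Y Z : Matrix (m ⊕ n) (m ⊕ n) R) : (Y * Z).toBlocks₁₂ =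
    Y.toBlocks₁₁ * Z.toBlocks₁₂ + Y.toBlocks₁₂ * Z.toBlocks₂₂ := by
  ext i j
  simp [Matrix.toBlocks₁₁, Matrix.toBlocks₁₂, Matrix.toBlocks₂₂, Matrix.mul_apply,
    Fintype.sum_sum_type]

theorem toBlocks₂₁_mul (Y Z : Matrix (m ⊕ n) (m ⊕ n) R) : (Y * Z).toBlocks₂₁ =
    Y.toBlocks₂₁ * Z.toBlocks₁₁ + Y.toBlocks₂₂ * Z.toBlocks₂₁ := by
  ext i j
  simp [Matrix.toBlocks₁₁, Matrix.toBlocks₂₂, Matrix.toBlocks₂₁, Matrix.mul_apply,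
    Fintype.sum_sum_type]

theorem toBlocks₂₂_mul (Y Z : Matrix (m ⊕ n) (m ⊕ n) R) : (Y * Z).toBlocks₂₂ =
    Y.toBlocks₂₁ * Z.toBlocks₁₂ + Y.toBlocks₂₂ * Z.toBlocks₂₂ := by
  ext i j
  simp [Matrix.toBlocks₂₂, Matrix.toBlocks₁₂, Matrix.toBlocks₂₁, Matrix.mul_apply,
    Fintype.sum_sum_type]

theorem toBlocks₁₁_one : (1 : Matrix (m ⊕ n) (m ⊕ n) R).toBlocks₁₁ = 1 := by
  rw [← Matrix.fromBlocks_one, Matrix.toBlocks_fromBlocks₁₁]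

theorem toBlocks₁₂_one : (1 : Matrix (m ⊕ n) (m ⊕ n) R).toBlocks₁₂ = 0 := by
  rw [← Matrix.fromBlocks_one, Matrix.toBlocks_fromBlocks₁₂]

theorem toBlocks₂₁_one : (1 : Matrix (m ⊕ n) (m ⊕ n) R).toBlocks₂₁ = 0 := by
  rw [← Matrix.fromBlocks_one, Matrix.toBlocks_fromBlocks₂₁]

theorem toBlocks₂₂_one : (1 : Matrix (m ⊕ n) (m ⊕ n) R).toBlocks₂₂ = 1 := by
  rw [← Matrix.fromBlocks_one, Matrix.toBlocks_fromBlocks₂₂]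

/-- The Schur complement of the lower right block. -/
def schur (Y : Matrix (m ⊕ n) (m ⊕ n) R) : Matrix m m R :=
  Y.toBlocks₁₁ - Y.toBlocks₁₂ * Ring.inverse Y.toBlocks₂₂ * Y.toBlocks₂₁

variable {Y : Matrix (m ⊕ n) (m ⊕ n) R} (hY : IsUnit Y) (hd : IsUnit Y.toBlocks₂₂)
include hY hd

theorem inverse_toBlocks₂₁ : (Ring.inverse Y).toBlocks₂₁ =
    -(Ring.inverse Y.toBlocks₂₂ * Y.toBlocks₂₁ * (Ring.inverse Y).toBlocks₁₁) := by
  have h := congrArg Matrix.toBlocks₂₁ (Ring.mul_inverse_cancel _ hY)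
  rw [toBlocks₂₁_mul, toBlocks₂₁_one] at h
  rw [eq_neg_iff_add_eq_zero, ← Matrix.one_mul (Ring.inverse Y).toBlocks₂₁,
    ← Ring.inverse_mul_cancel _ hd, Matrix.mul_assoc, Matrix.mul_assoc, ← Matrix.mul_add,
    add_comm, h, Matrix.mul_zero]

theorem inverse_toBlocks₁₂ : (Ring.inverse Y).toBlocks₁₂ =
    -((Ring.inverse Y).toBlocks₁₁ * (Y.toBlocks₁₂ * Ring.inverse Y.toBlocks₂₂)) := by
  have h := congrArg Matrix.toBlocks₁₂ (Ring.inverse_mul_cancel _ hY)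
  rw [toBlocks₁₂_mul, toBlocks₁₂_one] at h
  rw [eq_neg_iff_add_eq_zero, ← Matrix.mul_one (Ring.inverse Y).toBlocks₁₂,
    ← Ring.mul_inverse_cancel _ hd, ← Matrix.mul_assoc, ← Matrix.mul_assoc, ← Matrix.add_mul,
    add_comm, h, Matrix.zero_mul]

/-- The lower left block of Y Y⁻¹ = 1 expresses one block of Y⁻¹ through its upper left block.
Substituting it in the upper left equation leaves the Schur complement as a factor. -/
theorem schur_mul_inverse : schur Y * (Ring.inverse Y).toBlocks₁₁ = 1 := by
  have h := congrArg Matrix.toBlocks₁₁ (Ring.mul_inverse_cancel _ hY)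
  rw [toBlocks₁₁_mul, toBlocks₁₁_one, inverse_toBlocks₂₁ hY hd] at h
  rw [schur, Matrix.sub_mul, ← h, Matrix.mul_neg, sub_eq_add_neg]
  simp only [Matrix.mul_assoc]

theorem inverse_mul_schur : (Ring.inverse Y).toBlocks₁₁ * schur Y = 1 := by
  have h := congrArg Matrix.toBlocks₁₁ (Ring.inverse_mul_cancel _ hY)
  rw [toBlocks₁₁_mul, toBlocks₁₁_one, inverse_toBlocks₁₂ hY hd] at h
  rw [schur, Matrix.mul_sub, ← h, Matrix.neg_mul, sub_eq_add_neg]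
  simp only [Matrix.mul_assoc]

theorem isUnit_schur : IsUnit (schur Y) :=
  ⟨⟨_, _, schur_mul_inverse hY hd, inverse_mul_schur hY hd⟩, rfl⟩

end Schur

/-! ### Multiplicativity of the Berezinian. -/

section BerMul

variable {K : Type v} {R : Type w} [Field K] [CharZero K] [Ring R] [Algebra K R]
  (𝓡 : ZMod 2 → Submodule K R) [GradedAlgebra 𝓡] [IsColorCommutative (superSign K) 𝓡]
  {l m n : Type*} [Fintype l] [Fintype m] [DecidableEq m] [Fintype n] [DecidableEq n]

theorem even_mul_odd_mem {B : Matrix l m R} {C : Matrix m n R} (hB : ∀ i j, B i j ∈ 𝓡 0)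
    (hC : ∀ i j, C i j ∈ 𝓡 1) (i : l) (j : n) : (B * C) i j ∈ 𝓡 1 := by
  rw [Matrix.mul_apply]
  refine sum_mem fun k _ => ?_
  have h := SetLike.GradedMul.mul_mem (hB i k) (hC k j)
  rwa [zero_add] at h

theorem odd_mul_even_mem {B : Matrix l m R} {C : Matrix m n R} (hB : ∀ i j, B i j ∈ 𝓡 1)
    (hC : ∀ i j, C i j ∈ 𝓡 0) (i : l) (j : n) : (B * C) i j ∈ 𝓡 1 := by
  rw [Matrix.mul_apply]
  refine sum_mem fun k _ => ?_
  have h := SetLike.GradedMul.mul_mem (hB i k) (hC k j)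
  rwa [add_zero] at h

theorem even_mul_even_mem {B : Matrix l m R} {C : Matrix m n R} (hB : ∀ i j, B i j ∈ 𝓡 0)
    (hC : ∀ i j, C i j ∈ 𝓡 0) (i : l) (j : n) : (B * C) i j ∈ 𝓡 0 := by
  rw [Matrix.mul_apply]
  exact sum_mem fun k _ => mul_mem_even 𝓡 (hB i k) (hC k j)

/-- With b the relevant entry of B, the two determinants are 1 + bc and 1 + cb = 1 - bc, and (bc)² =
0. -/
theorem evenDet_one_add_mul_single {B : Matrix m n R} (hB : ∀ i j, B i j ∈ 𝓡 1) {c : R}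
    (hc : c ∈ 𝓡 1) (i : n) (j : m) :
    evenDet 𝓡 (1 + B * Matrix.single i j c) * evenDet 𝓡 (1 + Matrix.single i j c * B) = 1 := by
  refine Subtype.ext ?_
  have h : ((evenDet 𝓡 (1 + B * Matrix.single i j c) *
      evenDet 𝓡 (1 + Matrix.single i j c * B) : 𝓡 0) : R) =
      (evenDet 𝓡 (1 + B * Matrix.single i j c) : R) *
        (evenDet 𝓡 (1 + Matrix.single i j c * B) : R) := rfl
  rw [h, evenDet_one_add_single 𝓡 hB hc, evenDet_one_add_single_mul 𝓡 hB hc,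
    odd_mul_swap 𝓡 hc (hB j i)]
  have h1 := odd_mul_sq 𝓡 (hB j i) hc
  change (1 + B j i * c) * (1 + -(B j i * c)) = 1
  rw [mul_add, mul_one, mul_neg, add_mul, one_mul, h1, add_zero, add_neg_cancel_right]

/-- For odd matrices `B` and `C`, the determinants of `1 + B C` and `1 + C B` are inverse to each
other. -/
theorem evenDet_one_add_mul_comm {B : Matrix m n R} {C : Matrix n m R}
    (hB : ∀ i j, B i j ∈ 𝓡 1) (hC : ∀ i j, C i j ∈ 𝓡 1) :
    evenDet 𝓡 (1 + B * C) * evenDet 𝓡 (1 + C * B) = 1 := by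
  let _ := evenCommRing 𝓡
  -- The induction is on C, additively, with B universally quantified because the additive step
  -- replaces it by another odd matrix. Entries are taken in the odd part so that all summands
  -- remain odd.
  let P : Matrix n m (𝓡 1) → Prop := fun C => ∀ B : Matrix m n R, (∀ i j, B i j ∈ 𝓡 1) →
    evenDet 𝓡 (1 + B * C.map Subtype.val) * evenDet 𝓡 (1 + C.map Subtype.val * B) = 1
  have key : ∀ C, P C := by
    intro C
    refine Matrix.induction_on' (P := P) C ?_ ?_ ?_
    · intro B _
      have h0 : (0 : Matrix n m (𝓡 1)).map Subtype.val = (0 : Matrix n m R) := rfl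
      rw [h0, Matrix.mul_zero, Matrix.zero_mul, add_zero, add_zero, evenDet_one, evenDet_one,
        one_mul]
    · intro C D ihC ihD B hB
      have hadd : (C + D).map Subtype.val = C.map Subtype.val + D.map Subtype.val := rfl
      have hC : ∀ i j, C.map Subtype.val i j ∈ 𝓡 1 := fun i j => (C i j).2
      have hD : ∀ i j, D.map Subtype.val i j ∈ 𝓡 1 := fun i j => (D i j).2
      rw [hadd]
      specialize ihC B hB
      generalize C.map Subtype.val = C' at *
      have hU := isUnit_of_isUnit_evenDet 𝓡 (one_add_mul_mem_even 𝓡 hB hC)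
        (isUnit_evenDet_one_add 𝓡 hB hC)
      have hV := isUnit_of_isUnit_evenDet 𝓡 (one_add_mul_mem_even 𝓡 hC hB)
        (isUnit_evenDet_one_add 𝓡 hC hB)
      have hB' := even_mul_odd_mem 𝓡
        (inverse_mem_even 𝓡 (one_add_mul_mem_even 𝓡 hB hC) hU) hB
      -- The new matrix is B' = (1 + B C')⁻¹ B, which also equals B (1 + C' B)⁻¹. It factors 1 + B
      -- (C' + D') as (1 + B C')(1 + B' D') and 1 + (C' + D') B as (1 + D' B')(1 + C' B).
      have e1 : (1 + B * C') * (Ring.inverse (1 + B * C') * B) = B := by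
        rw [← Matrix.mul_assoc, Ring.mul_inverse_cancel _ hU, Matrix.one_mul]
      have e2 : (Ring.inverse (1 + B * C') * B) * (1 + C' * B) = B := by
        have h : B * (1 + C' * B) = (1 + B * C') * B := by
          rw [Matrix.mul_add, Matrix.add_mul, Matrix.mul_one, Matrix.one_mul, Matrix.mul_assoc]
        rw [Matrix.mul_assoc, h, ← Matrix.mul_assoc, Ring.inverse_mul_cancel _ hU, Matrix.one_mul]
      specialize ihD _ hB'
      generalize D.map Subtype.val = D' at *
      generalize Ring.inverse (1 + B * C') * B = B' at *
      have f1 : 1 + B * (C' + D') = (1 + B * C') * (1 + B' * D') := by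
        rw [Matrix.mul_add, Matrix.mul_add, Matrix.mul_one, ← Matrix.mul_assoc _ B', e1, add_assoc]
      have f2 : 1 + (C' + D') * B = (1 + D' * B') * (1 + C' * B) := by
        rw [Matrix.add_mul, Matrix.add_mul, Matrix.one_mul, Matrix.mul_assoc D', e2, add_assoc]
      rw [f1, f2, evenDet_mul 𝓡 (one_add_mul_mem_even 𝓡 hB hC) (one_add_mul_mem_even 𝓡 hB' hD),
        evenDet_mul 𝓡 (one_add_mul_mem_even 𝓡 hD hB') (one_add_mul_mem_even 𝓡 hC hB)]
      calc _ = (evenDet 𝓡 (1 + B * C') * evenDet 𝓡 (1 + C' * B)) *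
            (evenDet 𝓡 (1 + B' * D') * evenDet 𝓡 (1 + D' * B')) := by
              rw [mul_assoc, ← mul_assoc (evenDet 𝓡 (1 + B' * D')),
                mul_comm (evenDet 𝓡 (1 + B' * D') * evenDet 𝓡 (1 + D' * B')), ← mul_assoc]
        _ = 1 := by rw [ihC, ihD, one_mul]
    · intro i j x B hB
      have h : (Matrix.single i j x).map Subtype.val = (Matrix.single i j (x : R)) :=
        Matrix.map_single i j x (𝓡 1).subtype
      rw [h]
      exact evenDet_one_add_mul_single 𝓡 hB x.2 i j
  exact key (Matrix.of fun i j => ⟨C i j, hC i j⟩) B hB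

section Blocks

variable {𝓡} {Y : Matrix (m ⊕ n) (m ⊕ n) R}

theorem MemSuperGL.even₁₁ (hY : MemSuperGL 𝓡 Y) (i j : m) : Y.toBlocks₁₁ i j ∈ 𝓡 0 := by
  have h := hY.2 (Sum.inl i) (Sum.inl j)
  simp [superDegree] at h
  exact h

theorem MemSuperGL.odd₁₂ (hY : MemSuperGL 𝓡 Y) (i : m) (j : n) : Y.toBlocks₁₂ i j ∈ 𝓡 1 := by
  have h := hY.2 (Sum.inl i) (Sum.inr j)
  simp [superDegree] at h
  exact h

theorem MemSuperGL.odd₂₁ (hY : MemSuperGL 𝓡 Y) (i : n) (j : m) : Y.toBlocks₂₁ i j ∈ 𝓡 1 := by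
  have h := hY.2 (Sum.inr i) (Sum.inl j)
  simp [superDegree] at h
  exact h

theorem MemSuperGL.even₂₂ (hY : MemSuperGL 𝓡 Y) (i j : n) : Y.toBlocks₂₂ i j ∈ 𝓡 0 := by
  have h : Y (Sum.inr i) (Sum.inr j) ∈ 𝓡 (0 - 1 + 1) := hY.2 (Sum.inr i) (Sum.inr j)
  rw [sub_add_cancel] at h
  exact h

theorem MemSuperGL.inverse (hY : MemSuperGL 𝓡 Y) : MemSuperGL 𝓡 (Ring.inverse Y) :=
  ⟨hY.1.ringInverse, memMat_inv 𝓡 _ Y _ hY.2 (Ring.mul_inverse_cancel _ hY.1)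
    (Ring.inverse_mul_cancel _ hY.1)⟩

/-- The product of the odd-odd diagonal blocks of Y and Y⁻¹ is 1 plus a product of two matrices with
odd entries, so its determinant is a unit. -/
theorem MemSuperGL.isUnit_toBlocks₂₂ (hY : MemSuperGL 𝓡 Y) : IsUnit Y.toBlocks₂₂ := by
  let _ := evenCommRing 𝓡
  refine isUnit_of_isUnit_evenDet 𝓡 hY.even₂₂ ?_
  have e : Y.toBlocks₂₂ * (Ring.inverse Y).toBlocks₂₂ =
      1 + (-Y.toBlocks₂₁) * (Ring.inverse Y).toBlocks₁₂ := by
    have h := congrArg Matrix.toBlocks₂₂ (Ring.mul_inverse_cancel _ hY.1)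
    rw [toBlocks₂₂_mul, toBlocks₂₂_one] at h
    rw [← h, Matrix.neg_mul, add_neg_cancel_comm]
  have h := isUnit_evenDet_one_add 𝓡 (B := -Y.toBlocks₂₁)
    (fun i j => neg_mem (hY.odd₂₁ i j)) hY.inverse.odd₁₂
  rw [← e, evenDet_mul 𝓡 hY.even₂₂ hY.inverse.even₂₂] at h
  exact isUnit_of_mul_isUnit_left h

theorem MemSuperGL.schur_even (hY : MemSuperGL 𝓡 Y) (i j : m) : schur Y i j ∈ 𝓡 0 :=
  sub_mem (hY.even₁₁ i j) (mul_mem_even_of_odd 𝓡 (odd_mul_even_mem 𝓡 hY.odd₁₂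
    (inverse_mem_even 𝓡 hY.even₂₂ hY.isUnit_toBlocks₂₂)) hY.odd₂₁ i j)

theorem MemSuperGL.mul {Z : Matrix (m ⊕ n) (m ⊕ n) R} (hY : MemSuperGL 𝓡 Y)
    (hZ : MemSuperGL 𝓡 Z) : MemSuperGL 𝓡 (Y * Z) := by
  refine ⟨hY.1.mul hZ.1, fun i j => ?_⟩
  rw [Matrix.mul_apply]
  refine sum_mem fun k _ => ?_
  have h := SetLike.GradedMul.mul_mem (hY.2 i k) (hZ.2 k j)
  rwa [show ∀ a b c : ZMod 2, 0 - a + b + (0 - b + c) = 0 - a + c by intros; abel] at h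

/-- This form of the inverse of the Berezinian involves only blocks of Y and Y⁻¹, which behave
better under products than Schur complements. -/
theorem MemSuperGL.ber_mul_eq_one (hY : MemSuperGL 𝓡 Y) :
    ber 𝓡 Y * (evenDet 𝓡 Y.toBlocks₂₂ * evenDet 𝓡 (Ring.inverse Y).toBlocks₁₁) = 1 := by
  let _ := evenCommRing 𝓡
  have h1 : evenDet 𝓡 (schur Y) * evenDet 𝓡 (Ring.inverse Y).toBlocks₁₁ = 1 := by
    rw [← evenDet_mul 𝓡 hY.schur_even hY.inverse.even₁₁,
      schur_mul_inverse hY.1 hY.isUnit_toBlocks₂₂, evenDet_one]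
  have h2 := Ring.inverse_mul_cancel _ (isUnit_evenDet 𝓡 hY.even₂₂ hY.isUnit_toBlocks₂₂)
  change evenDet 𝓡 (schur Y) * Ring.inverse (evenDet 𝓡 Y.toBlocks₂₂) * _ = 1
  rw [mul_assoc, ← mul_assoc (Ring.inverse _), h2, one_mul, h1]

/-- The Berezinian is multiplicative. -/
theorem MemSuperGL.ber_mul {Z : Matrix (m ⊕ n) (m ⊕ n) R} (hY : MemSuperGL 𝓡 Y)
    (hZ : MemSuperGL 𝓡 Z) : ber 𝓡 (Y * Z) = ber 𝓡 Y * ber 𝓡 Z := by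
  let _ := evenCommRing 𝓡
  have hd := hY.isUnit_toBlocks₂₂
  have hd' := hZ.isUnit_toBlocks₂₂
  have hC := even_mul_odd_mem 𝓡 (inverse_mem_even 𝓡 hY.even₂₂ hd) hY.odd₂₁
  have hB := odd_mul_even_mem 𝓡 hZ.odd₁₂ (inverse_mem_even 𝓡 hZ.even₂₂ hd')
  -- The same two odd matrices, built from Y and from Z, occur here and in `e11`, in opposite
  -- orders.
  have e22 : (Y * Z).toBlocks₂₂ = Y.toBlocks₂₂ * (1 + (Ring.inverse Y.toBlocks₂₂ * Y.toBlocks₂₁) *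
      (Z.toBlocks₁₂ * Ring.inverse Z.toBlocks₂₂)) * Z.toBlocks₂₂ := by
    rw [toBlocks₂₂_mul, Matrix.mul_add, Matrix.add_mul, Matrix.mul_one, add_comm]
    congr 1
    simp only [Matrix.mul_assoc]
    rw [Ring.inverse_mul_cancel _ hd', Matrix.mul_one, ← Matrix.mul_assoc, ← Matrix.mul_assoc,
      Ring.mul_inverse_cancel _ hd, Matrix.one_mul]
  have einv : Ring.inverse (Y * Z) = Ring.inverse Z * Ring.inverse Y :=
    inverse_mul_of_isUnit hY.1 hZ.1
  have e11 : (Ring.inverse (Y * Z)).toBlocks₁₁ = (Ring.inverse Z).toBlocks₁₁ *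
      (1 + (Z.toBlocks₁₂ * Ring.inverse Z.toBlocks₂₂) *
        (Ring.inverse Y.toBlocks₂₂ * Y.toBlocks₂₁)) * (Ring.inverse Y).toBlocks₁₁ := by
    rw [einv, toBlocks₁₁_mul, inverse_toBlocks₁₂ hZ.1 hd', inverse_toBlocks₂₁ hY.1 hd,
      Matrix.neg_mul, Matrix.mul_neg, neg_neg, Matrix.mul_add, Matrix.add_mul, Matrix.mul_one]
    simp only [Matrix.mul_assoc]
  have d22 : evenDet 𝓡 (Y * Z).toBlocks₂₂ = _ := congrArg _ e22
  have d11 : evenDet 𝓡 (Ring.inverse (Y * Z)).toBlocks₁₁ = _ := congrArg _ e11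
  have comm := evenDet_one_add_mul_comm 𝓡 hB hC
  have m1 := one_add_mul_mem_even 𝓡 hB hC
  have m2 := one_add_mul_mem_even 𝓡 hC hB
  rw [evenDet_mul 𝓡 (even_mul_even_mem 𝓡 hY.even₂₂ m2) hZ.even₂₂,
    evenDet_mul 𝓡 hY.even₂₂ m2] at d22
  rw [evenDet_mul 𝓡 (even_mul_even_mem 𝓡 hZ.inverse.even₁₁ m1) hY.inverse.even₁₁,
    evenDet_mul 𝓡 hZ.inverse.even₁₁ m1] at d11
  have hYZ := (hY.mul hZ).ber_mul_eq_one
  rw [d22, d11] at hYZ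
  have hy := hY.ber_mul_eq_one
  have hz := hZ.ber_mul_eq_one
  exact eq_mul_of_mul_eq_one hYZ hy hz comm

end Blocks
end BerMul

/-! ### Symmetric biadditive forms and permutations. -/

section SymmetricForm

variable {G M : Type*} [AddCommGroup G] [AddCommGroup M] {r : ℕ}

/-- By symmetry both sides are sums over unordered pairs of distinct indices, and σ permutes these
pairs. -/
theorem sum_Ioi_comp_perm (σ : Equiv.Perm (Fin r)) (f : Fin r → Fin r → M)
    (hf : ∀ i j, f i j = f j i) :
    ∑ i, ∑ j ∈ Finset.Ioi i, f (σ i) (σ j) = ∑ i, ∑ j ∈ Finset.Ioi i, f i j := by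
  have key : ∀ p : Sym2 (Fin r) → M, ∑ i, ∑ j ∈ Finset.Ioi i, p s(i, j) =
      ∑ z : Sym2 (Fin r) with ¬ z.IsDiag, p z := by
    intro p
    have h := Finset.sum_sym2_filter_not_isDiag (Finset.univ : Finset (Fin r)) p
    rw [Finset.sym2_univ] at h
    rw [h, Finset.sum_sigma']
    refine Finset.sum_bij' (fun x _ => (x.1, x.2)) (fun x _ => ⟨x.1, x.2⟩) ?_ ?_ ?_ ?_ ?_
    · rintro ⟨i, j⟩ hx
      have hlt : i < j := by simpa using hx
      simpa [hlt] using hlt.ne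
    · rintro ⟨i, j⟩ hx
      simp at hx
      simpa using hx.2
    · intros; rfl
    · intros; rfl
    · intros; rfl
  let p : Sym2 (Fin r) → M := Sym2.lift ⟨f, hf⟩
  have h1 := key p
  have h2 := key (fun z => p (z.map σ))
  refine (h2.trans ?_).trans h1.symm
  refine Finset.sum_equiv
    (Equiv.ofBijective _ (Sym2.map.injective σ.injective).bijective_of_finite) ?_ ?_
  · intro z
    induction z with | _ i j
    simp
  · intros; rfl

theorem sum_Ioi_add_swap (g : Fin r → Fin r → M) :
    ∑ i, ∑ j ∈ Finset.Ioi i, (g i j + g j i) = ∑ i, ∑ j, g i j - ∑ i, g i i := by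
  rw [Finset.sum_sum_Ioi_add_eq_sum_sum_off_diag (fun i j => g j i), ← Finset.sum_sub_distrib]
  refine Finset.sum_congr rfl fun i _ => ?_
  rw [eq_sub_iff_add_eq', ← Finset.sum_singleton (g i) i, Finset.sum_add_sum_compl]

/-- A symmetric biadditive form summed over the pairs of the differences `ν i - ν (σ i)`. -/
theorem sum_Ioi_symm_form (B : G →+ G →+ M) (hB : ∀ x y, B x y = B y x) (ν : Fin r → G)
    (σ : Equiv.Perm (Fin r)) :
    ∑ i, ∑ j ∈ Finset.Ioi i, B (ν i - ν (σ i)) (ν j - ν (σ j)) =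
      ∑ i, B (ν (σ i)) (ν i - ν (σ i)) := by
  -- The differences sum to 0, so expanding the full double sum proves twice the identity. As the
  -- values may have 2-torsion (such as -1 in `Kˣ`), the sums over i < j are computed directly:
  -- σ-invariance treats the unmixed terms, and the mixed ones pair up into an off-diagonal sum.
  have h1 := sum_Ioi_comp_perm σ (fun i j => B (ν i) (ν j)) fun i j => hB _ _
  have h2 := sum_Ioi_add_swap (fun i j => B (ν i) (ν (σ j)))
  have h3 := sum_Ioi_add_swap (fun i j => B (ν i) (ν j))
  have h4 : ∀ i, ∑ j, B (ν i) (ν (σ j)) = ∑ j, B (ν i) (ν j) := fun i =>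
    Equiv.sum_comp σ fun j => B (ν i) (ν j)
  have h5 : ∑ i, B (ν (σ i)) (ν (σ i)) = ∑ i, B (ν i) (ν i) :=
    Equiv.sum_comp σ fun j => B (ν j) (ν j)
  have h6 : ∀ i j, B (ν i - ν (σ i)) (ν j - ν (σ j)) = B (ν i) (ν j) +
      B (ν (σ i)) (ν (σ j)) - (B (ν i) (ν (σ j)) + B (ν j) (ν (σ i))) := by
    intro i j
    rw [hB (ν j)]
    simp only [map_sub, AddMonoidHom.sub_apply]
    abel
  have h7 : ∑ i, B (ν (σ i)) (ν i) = ∑ i, B (ν i) (ν (σ i)) :=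
    Finset.sum_congr rfl fun i _ => hB _ _
  have h8 : ∑ i, ∑ j ∈ Finset.Ioi i, (B (ν i) (ν j) + B (ν j) (ν i)) =
      ∑ i, ∑ j ∈ Finset.Ioi i, B (ν i) (ν j) + ∑ i, ∑ j ∈ Finset.Ioi i, B (ν i) (ν j) := by
    simp only [← Finset.sum_add_distrib]
    exact Finset.sum_congr rfl fun i _ => Finset.sum_congr rfl fun j _ => by rw [hB (ν j)]
  simp only [h4] at h2
  rw [h8] at h3
  have h9 : ∑ i, B (ν (σ i)) (ν i - ν (σ i)) =
      ∑ i, B (ν i) (ν (σ i)) - ∑ i, B (ν i) (ν i) := by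
    simp only [map_sub, Finset.sum_sub_distrib, h5, h7]
  rw [h9]
  simp only [h6, Finset.sum_sub_distrib]
  rw [h2]
  simp only [Finset.sum_add_distrib]
  rw [h1, h3]
  abel

end SymmetricForm

/-! ### Comparison of two multipliers. -/

section Multiplier

variable {Γ : Type u} {K : Type v} [AddCommGroup Γ] [Field K] {lam : CommutationFactor Γ K}
  (s s' : NSMultiplier lam)

theorem NSMultiplier.neg_left (x y : Γ) : s (-x) y = (s x y)⁻¹ := by
  rw [eq_inv_iff_mul_eq_one, ← s.add_left, neg_add_cancel, s.zero_left]

theorem NSMultiplier.neg_right (x y : Γ) : s x (-y) = (s x y)⁻¹ := by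
  rw [eq_inv_iff_mul_eq_one, ← s.add_right, neg_add_cancel, s.zero_right]

theorem NSMultiplier.sub_left (x y z : Γ) : s (x - y) z = s x z * (s y z)⁻¹ := by
  rw [sub_eq_add_neg, s.add_left, s.neg_left]

theorem NSMultiplier.sub_right (x y z : Γ) : s z (x - y) = s z x * (s z y)⁻¹ := by
  rw [sub_eq_add_neg, s.add_right, s.neg_right]

theorem NSMultiplier.sum_right {ι : Type*} (t : Finset ι) (x : Γ) (f : ι → Γ) :
    s x (∑ i ∈ t, f i) = ∏ i ∈ t, s x (f i) := by
  classical
  induction t using Finset.induction_on with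
  | empty => simp [s.zero_right]
  | insert i t hi ih => rw [Finset.sum_insert hi, Finset.prod_insert hi, s.add_right, ih]

theorem NSMultiplier.nsmul_left (k : ℕ) (x y : Γ) : s (k • x) y = s x y ^ k := by
  induction k with
  | zero => rw [zero_nsmul, pow_zero, s.zero_left]
  | succ k ih => rw [succ_nsmul, pow_succ, s.add_left, ih]

theorem NSMultiplier.nsmul_right (k : ℕ) (x y : Γ) : s x (k • y) = s x y ^ k := by
  induction k with
  | zero => rw [zero_nsmul, pow_zero, s.zero_right]
  | succ k ih => rw [succ_nsmul, pow_succ, s.add_right, ih]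

/-- The quotient of two multipliers, as a biadditive form. -/
def NSMultiplier.quotForm : Γ →+ Γ →+ Additive Kˣ :=
  AddMonoidHom.mk' (fun x => AddMonoidHom.mk' (fun y => Additive.ofMul (s' x y / s x y))
    fun y z => by
      rw [← ofMul_mul, s.add_right, s'.add_right, mul_div_mul_comm])
    fun x y => by
      ext z
      simp [s.add_left, s'.add_left, mul_div_mul_comm]

theorem NSMultiplier.quotForm_apply (x y : Γ) :
    quotForm s s' x y = Additive.ofMul (s' x y / s x y) := rfl

/-- The twist condition fixes s(x,y) / s(y,x) in terms of `lam` alone, so this ratio is the same for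
both multipliers. -/
theorem NSMultiplier.quotForm_symm (x y : Γ) : quotForm s s' x y = quotForm s s' y x := by
  rw [quotForm_apply, quotForm_apply]
  congr 1
  have h := (s.twist x y).trans (s'.twist x y).symm
  rw [mul_assoc, mul_assoc, mul_right_inj, ← div_eq_mul_inv, ← div_eq_mul_inv] at h
  rw [div_eq_div_iff_mul_eq_mul] at h ⊢
  rw [← h, mul_comm]

/-- The coefficient of the term of a permutation in the graded determinant. -/
def NSMultiplier.detCoeff {r : ℕ} (ν : Fin r → Γ) (x : Γ) (σ : Equiv.Perm (Fin r)) : Kˣ :=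
  (∏ i, ∏ j ∈ Finset.Ioi i, s (x - ν (σ i) + ν i) (x - ν (σ j) + ν j)) *
    ∏ i, (s x (ν i) * (s (ν (σ i)) (x - ν (σ i) + ν i))⁻¹)

/-- With d i = ν i - ν (σ i), in degree 0 the coefficient is the product of s(d i, d j) over i < j,
divided by the product of s(ν (σ i), d i). The quotient of the coefficients for two multipliers is 1
by `sum_Ioi_symm_form`. -/
theorem NSMultiplier.detCoeff_zero {r : ℕ} (ν : Fin r → Γ) (σ : Equiv.Perm (Fin r)) :
    s.detCoeff ν 0 σ = s'.detCoeff ν 0 σ := by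
  have h := sum_Ioi_symm_form (quotForm s s') (quotForm_symm s s') ν σ
  have h' := congrArg Additive.toMul h
  simp only [quotForm_apply, toMul_sum, toMul_ofMul, Finset.prod_div_distrib] at h'
  have e : ∀ i, 0 - ν (σ i) + ν i = ν i - ν (σ i) := fun i => by abel
  simp only [detCoeff, e, s.zero_left, s'.zero_left, one_mul, Finset.prod_inv_distrib]
  rw [← div_eq_mul_inv, ← div_eq_mul_inv]
  rw [div_eq_div_iff_mul_eq_mul] at h' ⊢
  rw [mul_comm, ← h', mul_comm]

end Multiplier

/-! ### Inverses of homogeneous matrices and elements. -/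

section HomogeneousInverse

variable {Γ : Type*} {K : Type v} {A : Type w} [AddCommGroup Γ] [DecidableEq Γ] [Field K] [Ring A]
  [Algebra K A] (𝒜 : Γ → Submodule K A) [GradedAlgebra 𝒜] {n : Type*} [Fintype n] [DecidableEq n]

/-- Since X is homogeneous, the component of Y of degree -x is already a right inverse of X, hence
equals Y. -/
theorem memMat_neg_of_mul_eq_one {ν : n → Γ} {x : Γ} {X Y : Matrix n n A} (hX : MemMat 𝒜 ν x X)
    (h1 : X * Y = 1) (h2 : Y * X = 1) : MemMat 𝒜 ν (-x) Y := by
  let P : Matrix n n A :=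
    Matrix.of fun i j => (DirectSum.decompose 𝒜 (Y i j) (-x - ν i + ν j) : A)
  have hP : X * P = 1 := by
    ext i j
    have e : (X * Y) i j = (1 : Matrix n n A) i j := by rw [h1]
    have e2 := congrArg (GradedAlgebra.proj 𝒜 (0 - ν i + ν j)) e
    rw [Matrix.mul_apply, map_sum] at e2
    simp only [GradedAlgebra.proj_apply] at e2
    have e3 : ∀ k, (DirectSum.decompose 𝒜 (X i k * Y k j) (0 - ν i + ν j) : A) = X i k * P k j := by
      intro k
      have h := DirectSum.coe_decompose_mul_add_of_left_mem (j := -x - ν k + ν j) 𝒜 (b := Y k j)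
        (hX i k)
      rwa [show x - ν i + ν k + (-x - ν k + ν j) = 0 - ν i + ν j by abel] at h
    simp only [e3] at e2
    rw [Matrix.mul_apply, e2]
    by_cases hij : i = j
    · subst hij
      rw [Matrix.one_apply_eq, show (0 : Γ) - ν i + ν i = 0 by abel]
      exact DirectSum.decompose_of_mem_same 𝒜 (SetLike.GradedOne.one_mem (A := 𝒜))
    · rw [Matrix.one_apply_ne hij, DirectSum.decompose_zero]
      rfl
  have hYP : Y = P := by
    calc Y = Y * (X * P) := by rw [hP, mul_one]
      _ = P := by rw [← mul_assoc, h2, one_mul]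
  intro i j
  rw [hYP]
  exact (DirectSum.decompose 𝒜 (Y i j) (-x - ν i + ν j)).2

theorem memMat_inverse {ν : n → Γ} {x : Γ} {X : Matrix n n A} (hX : MemMat 𝒜 ν x X)
    (h : IsUnit X) : MemMat 𝒜 ν (-x) (Ring.inverse X) :=
  memMat_neg_of_mul_eq_one 𝒜 hX (Ring.mul_inverse_cancel _ h) (Ring.inverse_mul_cancel _ h)

/-- This is the matrix statement for 1 × 1 matrices of weight 0. -/
theorem inverse_mem {x : Γ} {a : A} (ha : a ∈ 𝒜 x) (h : IsUnit a) : Ring.inverse a ∈ 𝒜 (-x) := by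
  have h1 : ∀ b c : A, b * c = 1 →
      (Matrix.of fun _ _ => b : Matrix Unit Unit A) * (Matrix.of fun _ _ => c) = 1 := by
    intro b c hbc
    ext i j
    simp [Matrix.mul_apply, hbc]
  have h2 := memMat_neg_of_mul_eq_one 𝒜 (ν := fun _ : Unit => 0) (x := x)
    (X := Matrix.of fun _ _ => a) (fun _ _ => by simpa using ha)
    (h1 _ _ (Ring.mul_inverse_cancel _ h)) (h1 _ _ (Ring.inverse_mul_cancel _ h))
  simpa using h2 () ()

theorem units_smul_mem {x : Γ} (c : Kˣ) {a : A} (ha : a ∈ 𝒜 x) : c • a ∈ 𝒜 x :=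
  Submodule.smul_mem _ (c : K) ha

end HomogeneousInverse

/-! ### Products and inverses in the twisted algebra. -/

section Twist

variable {Γ : Type u} {K : Type v} {A : Type w} [AddCommGroup Γ] [DecidableEq Γ] [Field K]
  [Ring A] [Algebra K A] {lam : CommutationFactor Γ K} (𝒜 : Γ → Submodule K A) [GradedAlgebra 𝒜]
  (s : NSMultiplier lam)

theorem toTwist_units_smul (c : Kˣ) (a : A) : toTwist 𝒜 s (c • a) = c • toTwist 𝒜 s a := rfl

theorem toTwist_mul_toTwist {α β : Γ} {a b : A} (ha : a ∈ 𝒜 α) (hb : b ∈ 𝒜 β) :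
    toTwist 𝒜 s a * toTwist 𝒜 s b = s α β • toTwist 𝒜 s (a * b) := by
  rw [← toTwist_starMul, starMul_of_mem 𝒜 s ha hb, toTwist_units_smul]

theorem toTwist_one : toTwist 𝒜 s 1 = 1 := rfl

theorem mem_regrade_of_superGrading {i : ZMod 2} {b : Twist 𝒜 s}
    (hb : b ∈ Twist.superGrading 𝒜 s i) : (toTwist 𝒜 s).symm b ∈ regrade 𝒜 lam.parity i := by
  refine regrade_induction (Twist.grading 𝒜 s)
    (p := fun b => (toTwist 𝒜 s).symm b ∈ regrade 𝒜 lam.parity i) ?_ ?_ ?_ hb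
  · rintro γ rfl _ ⟨a, ha, rfl⟩
    exact le_regrade 𝒜 lam.parity γ ha
  · rw [map_zero]
    exact zero_mem _
  · intro b c hb hc
    rw [map_add]
    exact add_mem hb hc

theorem mem_of_toTwist_mem {γ : Γ} {a : A} (h : toTwist 𝒜 s a ∈ Twist.grading 𝒜 s γ) : a ∈ 𝒜 γ := by
  obtain ⟨b, hb, e⟩ := h
  have : b = a := (toTwist 𝒜 s).injective e
  exact this ▸ hb

theorem isUnit_of_isUnit_toTwist {α : Γ} {a : A} (ha : a ∈ 𝒜 α) (h : IsUnit (toTwist 𝒜 s a)) :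
    IsUnit a := by
  obtain ⟨b, hb⟩ : ∃ b, toTwist 𝒜 s b = Ring.inverse (toTwist 𝒜 s a) :=
    (toTwist 𝒜 s).surjective _
  have hbm : b ∈ 𝒜 (-α) := by
    refine mem_of_toTwist_mem 𝒜 s ?_
    rw [hb]
    exact inverse_mem (Twist.grading 𝒜 s) (toTwist_mem 𝒜 s ha) h
  have h1 : toTwist 𝒜 s (s α (-α) • (a * b)) = toTwist 𝒜 s 1 := by
    rw [toTwist_units_smul, ← toTwist_mul_toTwist 𝒜 s ha hbm, hb, Ring.mul_inverse_cancel _ h,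
      toTwist_one]
  have h2 : toTwist 𝒜 s (s (-α) α • (b * a)) = toTwist 𝒜 s 1 := by
    rw [toTwist_units_smul, ← toTwist_mul_toTwist 𝒜 s hbm ha, hb, Ring.inverse_mul_cancel _ h,
      toTwist_one]
  -- The two scalars agree, so one multiple of b serves as both left and right inverse.
  have e : s (-α) α = s α (-α) := by rw [s.neg_left, s.neg_right]
  rw [e] at h2
  refine ⟨⟨a, s α (-α) • b, ?_, ?_⟩, rfl⟩
  · rw [mul_smul_comm]
    exact (toTwist 𝒜 s).injective h1
  · rw [smul_mul_assoc]
    exact (toTwist 𝒜 s).injective h2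

/-- The twisted product of a and its original inverse is s(α,-α) = s(α,α)⁻¹, which the scalar
compensates. -/
theorem inverse_toTwist {α : Γ} {a : A} (ha : a ∈ 𝒜 α) (h : IsUnit a) :
    Ring.inverse (toTwist 𝒜 s a) = s α α • toTwist 𝒜 s (Ring.inverse a) := by
  have hb := inverse_mem 𝒜 ha h
  have h1 := toTwist_mul_toTwist 𝒜 s ha hb
  have h2 := toTwist_mul_toTwist 𝒜 s hb ha
  rw [Ring.mul_inverse_cancel _ h, s.neg_right, toTwist_one] at h1
  rw [Ring.inverse_mul_cancel _ h, s.neg_left, toTwist_one] at h2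
  have e1 : toTwist 𝒜 s a * (s α α • toTwist 𝒜 s (Ring.inverse a)) = 1 := by
    rw [mul_smul_comm, h1, smul_inv_smul]
  have e2 : (s α α • toTwist 𝒜 s (Ring.inverse a)) * toTwist 𝒜 s a = 1 := by
    rw [smul_mul_assoc, h2, smul_inv_smul]
  exact Ring.inverse_unit ⟨_, _, e1, e2⟩

theorem prod_ofFn_mem {r : ℕ} {γ : Fin r → Γ} {a : Fin r → A} (ha : ∀ i, a i ∈ 𝒜 (γ i)) :
    (List.ofFn a).prod ∈ 𝒜 (∑ i, γ i) := by
  rw [← List.sum_ofFn]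
  exact SetLike.list_prod_ofFn_mem_graded γ a ha

/-- Splitting off the first factor costs s(γ 0, sum of the other degrees), which biadditivity turns
into the terms with i = 0. -/
theorem prod_ofFn_toTwist {r : ℕ} {γ : Fin r → Γ} {a : Fin r → A} (ha : ∀ i, a i ∈ 𝒜 (γ i)) :
    (List.ofFn fun i => toTwist 𝒜 s (a i)).prod =
      (∏ i, ∏ j ∈ Finset.Ioi i, s (γ i) (γ j)) • toTwist 𝒜 s (List.ofFn a).prod := by
  induction r with
  | zero => simp [toTwist_one]
  | succ r ih =>
    rw [List.ofFn_succ, List.prod_cons, List.ofFn_succ, List.prod_cons,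
      ih (γ := fun i => γ i.succ) (a := fun i => a i.succ) fun i => ha i.succ, mul_smul_comm,
      toTwist_mul_toTwist 𝒜 s (ha 0) (prod_ofFn_mem 𝒜 fun i => ha i.succ), smul_smul,
      Fin.prod_univ_succ, Fin.prod_Ioi_zero, s.sum_right, mul_comm]
    simp only [Fin.prod_Ioi_succ]

end Twist

/-! ### The map J on rectangular matrices. -/

section J

variable {Γ : Type u} {K : Type v} {A : Type w} [AddCommGroup Γ] [DecidableEq Γ] [Field K]
  [Ring A] [Algebra K A] {lam : CommutationFactor Γ K} (𝒜 : Γ → Submodule K A) [GradedAlgebra 𝒜]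
  (s : NSMultiplier lam) {l m n : Type*}

/-- The map `gradedJ` for matrices whose rows and columns are graded by different families. -/
def rectJ (ν : m → Γ) (μ : n → Γ) (X : Matrix m n A) : Matrix m n (Twist 𝒜 s) :=
  Matrix.of fun i j => toTwist 𝒜 s
    (rescale 𝒜 (fun γ => s (γ + ν i - μ j) (μ j) * (s (ν i) γ)⁻¹) (X i j))

theorem rectJ_apply {ν : m → Γ} {μ : n → Γ} {x : Γ} {X : Matrix m n A}
    (hX : ∀ i j, X i j ∈ 𝒜 (x - ν i + μ j)) (i : m) (j : n) : rectJ 𝒜 s ν μ X i j =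
      (s x (μ j) * (s (ν i) (x - ν i + μ j))⁻¹) • toTwist 𝒜 s (X i j) := by
  simp only [rectJ, Matrix.of_apply]
  rw [rescale_of_mem 𝒜 _ (hX i j), show x - ν i + μ j + ν i - μ j = x by abel]
  rfl

theorem rectJ_sub (ν : m → Γ) (μ : n → Γ) (X Y : Matrix m n A) :
    rectJ 𝒜 s ν μ (X - Y) = rectJ 𝒜 s ν μ X - rectJ 𝒜 s ν μ Y := by
  ext i j
  simp [rectJ]

/-- The failure of multiplicativity depends only on the two degrees, and disappears when one of them
is 0. The rectangular version is what the off-diagonal blocks require. -/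
theorem rectJ_mul [Fintype m] {ν : l → Γ} {μ : m → Γ} {κ : n → Γ} {x y : Γ} {X : Matrix l m A}
    {Y : Matrix m n A} (hX : ∀ i j, X i j ∈ 𝒜 (x - ν i + μ j))
    (hY : ∀ i j, Y i j ∈ 𝒜 (y - μ i + κ j)) :
    rectJ 𝒜 s ν μ X * rectJ 𝒜 s μ κ Y = s x y • rectJ 𝒜 s ν κ (X * Y) := by
  have hXY : ∀ i k j, X i k * Y k j ∈ 𝒜 (x + y - ν i + κ j) := by
    intro i k j
    have h := SetLike.GradedMul.mul_mem (hX i k) (hY k j)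
    rwa [show x - ν i + μ k + (y - μ k + κ j) = x + y - ν i + κ j by abel] at h
  ext i j
  rw [Matrix.smul_apply, rectJ_apply 𝒜 s (x := x + y)
    (fun i j => by rw [Matrix.mul_apply]; exact sum_mem fun k _ => hXY i k j), Matrix.mul_apply,
    Matrix.mul_apply, map_sum, Finset.smul_sum, Finset.smul_sum]
  refine Finset.sum_congr rfl fun k _ => ?_
  rw [rectJ_apply 𝒜 s hX, rectJ_apply 𝒜 s hY, smul_mul_smul_comm,
    toTwist_mul_toTwist 𝒜 s (hX i k) (hY k j), smul_smul, smul_smul]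
  congr 1
  -- After expansion by biadditivity, every factor involving the middle weight `μ k` cancels.
  simp only [s.add_left, s.add_right, s.sub_left, s.sub_right]
  ext
  push_cast
  field_simp

end J

/-! ### Existence of multipliers on a finitely generated group. -/

section Existence

/-- A decomposition of the identity of `G` into finitely many endomorphisms of cyclic image. -/
def HasCyclicDecomposition (G : Type*) [AddCommGroup G] : Prop :=
  ∃ (k : ℕ) (p : Fin k → G →+ G) (g : Fin k → G), (∀ x, ∑ i, p i x = x) ∧
    ∀ i x, ∃ z : ℤ, p i x = z • g i

variable {G H : Type*} [AddCommGroup G] [AddCommGroup H]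

theorem hasCyclicDecomposition_of_fintype {ι : Type*} [Fintype ι] (p : ι → G →+ G) (g : ι → G)
    (h1 : ∀ x, ∑ i, p i x = x) (h2 : ∀ i x, ∃ z : ℤ, p i x = z • g i) :
    HasCyclicDecomposition G := by
  let e := (Fintype.equivFin ι).symm
  exact ⟨_, fun i => p (e i), fun i => g (e i),
    fun x => (Equiv.sum_comp e fun i => p i x).trans (h1 x), fun i => h2 (e i)⟩

theorem HasCyclicDecomposition.of_equiv (e : G ≃+ H) (h : HasCyclicDecomposition H) :
    HasCyclicDecomposition G := by
  obtain ⟨k, p, g, h1, h2⟩ := h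
  refine ⟨k, fun i => (e.symm.toAddMonoidHom.comp (p i)).comp e.toAddMonoidHom,
    fun i => e.symm (g i), fun x => ?_, fun i x => ?_⟩
  · have h := congrArg e.symm (h1 (e x))
    rw [map_sum, e.symm_apply_apply] at h
    exact h
  · obtain ⟨z, hz⟩ := h2 i (e x)
    refine ⟨z, ?_⟩
    rw [← map_zsmul, ← hz]
    rfl

theorem HasCyclicDecomposition.prod (hG : HasCyclicDecomposition G)
    (hH : HasCyclicDecomposition H) : HasCyclicDecomposition (G × H) := by
  obtain ⟨k, p, g, h1, h2⟩ := hG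
  obtain ⟨l, q, h, h3, h4⟩ := hH
  refine hasCyclicDecomposition_of_fintype (ι := Fin k ⊕ Fin l)
    (Sum.elim (fun i => ((AddMonoidHom.inl G H).comp (p i)).comp (AddMonoidHom.fst G H))
      fun i => ((AddMonoidHom.inr G H).comp (q i)).comp (AddMonoidHom.snd G H))
    (Sum.elim (fun i => (g i, 0)) fun i => (0, h i)) ?_ ?_
  · rintro ⟨x, y⟩
    rw [Fintype.sum_sum_type]
    ext
    · simp [Prod.fst_sum, h1]
    · simp [Prod.snd_sum, h3]
  · rintro (i | i) ⟨x, y⟩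
    · obtain ⟨z, hz⟩ := h2 i x
      exact ⟨z, by simp [hz]⟩
    · obtain ⟨z, hz⟩ := h4 i y
      exact ⟨z, by simp [hz]⟩

theorem hasCyclicDecomposition_directSum {ι : Type*} [Fintype ι] (G : ι → Type*)
    [∀ i, AddCommGroup (G i)] (g : ∀ i, G i) (hg : ∀ i x, ∃ z : ℤ, x = z • g i) :
    HasCyclicDecomposition (⨁ i, G i) := by
  classical
  refine hasCyclicDecomposition_of_fintype
    (fun i => (DirectSum.of G i).comp (DFinsupp.evalAddMonoidHom i))
    (fun i => DirectSum.of G i (g i)) (fun x => ?_) fun i x => ?_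
  · exact DirectSum.sum_univ_of x
  · obtain ⟨z, hz⟩ := hg i (x i)
    refine ⟨z, ?_⟩
    rw [← map_zsmul, ← hz]
    rfl

/-- By the structure theorem the group is a sum of copies of ℤ and finite cyclic groups, with the
projections as endomorphisms. -/
theorem hasCyclicDecomposition_of_fg (G : Type*) [AddCommGroup G] [AddGroup.FG G] :
    HasCyclicDecomposition G := by
  obtain ⟨n, ι, _, p, _, e, ⟨f⟩⟩ := AddCommGroup.equiv_free_prod_directSum_zmod G
  refine HasCyclicDecomposition.of_equiv f (HasCyclicDecomposition.prod ?_ ?_)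
  · classical
    refine HasCyclicDecomposition.of_equiv (finsuppAddEquivDFinsupp (ι := Fin n) (M := ℤ))
      (hasCyclicDecomposition_directSum (fun _ : Fin n => ℤ) (fun _ => 1) fun _ x => ⟨x, by simp⟩)
  · exact hasCyclicDecomposition_directSum _ (fun _ => 1) fun i x =>
      ⟨x.cast, by rw [zsmul_one, ZMod.intCast_zmod_cast]⟩

/-- An alternating form on a finitely generated group is the alternation of a biadditive form. -/
theorem exists_alternation {M : Type*} [AddCommGroup M] [AddGroup.FG G] (B : G →+ G →+ M)
    (hB : ∀ x, B x x = 0) : ∃ C : G →+ G →+ M, ∀ x y, C x y - C y x = B x y := by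
  obtain ⟨k, p, g, h1, h2⟩ := hasCyclicDecomposition_of_fg G
  have hs : ∀ x y, B x y = -B y x := by
    intro x y
    have h := hB (x + y)
    simp only [map_add, AddMonoidHom.add_apply, hB, zero_add, add_zero] at h
    exact eq_neg_of_add_eq_zero_right h
  -- An alternating form vanishes on a cyclic subgroup.
  have hc : ∀ i x y, B (p i x) (p i y) = 0 := by
    intro i x y
    obtain ⟨z, hz⟩ := h2 i x
    obtain ⟨t, ht⟩ := h2 i y
    rw [hz, ht]
    simp [hB]
  -- C is the strictly upper triangular half of B. Antisymmetry makes -C(y,x) the lower half, and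
  -- the diagonal vanishes by `hc`.
  let C : G →+ G →+ M := ∑ i, ∑ j ∈ Finset.Ioi i, (B.compl₂ (p j)).comp (p i)
  have hC : ∀ x y, C x y = ∑ i, ∑ j ∈ Finset.Ioi i, B (p i x) (p j y) := by
    intro x y
    simp [C]
  refine ⟨C, fun x y => ?_⟩
  have h := sum_Ioi_add_swap (fun i j => B (p i x) (p j y))
  simp only [hc, Finset.sum_const_zero, sub_zero] at h
  rw [hC, hC, sub_eq_add_neg]
  simp only [← Finset.sum_neg_distrib, ← hs, ← Finset.sum_add_distrib]
  rw [h]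
  simp only [← map_sum, h1]
  rw [← AddMonoidHom.finsetSum_apply, ← map_sum, h1]

variable {Γ : Type u} {K : Type v} [AddCommGroup Γ] [Field K]

theorem superSign_add_left (a b c : ZMod 2) :
    superSign K (a + b) c = superSign K a c * superSign K b c := by
  rw [superSign, superSign, superSign, ← pow_add, add_mul, ZMod.val_add]
  exact (pow_eq_pow_mod _ (neg_one_sq (R := Kˣ))).symm

theorem superSign_comm (a b : ZMod 2) : superSign K a b = superSign K b a := by
  rw [superSign, superSign, mul_comm]

theorem superSign_parity (lam : CommutationFactor Γ K) (x : Γ) :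
    superSign K (lam.parity x) (lam.parity x) = lam x x := by
  classical
  have h : lam.parity x = if lam x x = 1 then 0 else 1 := rfl
  split_ifs at h with h1
  · rw [h, h1]
    simp [superSign]
  · rw [h, (lam.self_eq x).resolve_left h1]
    simp [superSign, ZMod.val_one]

/-- Multipliers exist on finitely generated groups. -/
theorem NSMultiplier.nonempty [AddGroup.FG Γ] (lam : CommutationFactor Γ K) :
    Nonempty (NSMultiplier lam) := by
  let B : Γ →+ Γ →+ Additive Kˣ :=
    AddMonoidHom.mk' (fun x => AddMonoidHom.mk' (fun y => Additive.ofMul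
      (superSign K (lam.parity x) (lam.parity y) / lam x y)) fun y z => by
        rw [← ofMul_mul, lam.add_right, map_add, superSign_comm, superSign_add_left,
          superSign_comm _ (lam.parity x), superSign_comm _ (lam.parity x), mul_div_mul_comm])
      fun x y => by
        ext z
        simp [lam.add_left, superSign_add_left, mul_div_mul_comm]
  have hB : ∀ x y, B x y = Additive.ofMul
    (superSign K (lam.parity x) (lam.parity y) / lam x y) := fun _ _ => rfl
  -- The sign rule and `lam` agree on the diagonal, so their quotient is alternating. A form with
  -- this alternation satisfies the twist condition.
  obtain ⟨C, hC⟩ := exists_alternation B fun x => by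
    rw [hB, superSign_parity, div_self', ofMul_one]
  refine ⟨⟨fun x y => (C x y).toMul, fun x y z => ?_, fun x y z => ?_, fun x y => ?_⟩⟩
  · rw [map_add, AddMonoidHom.add_apply, toMul_add]
  · rw [map_add, toMul_add]
  · have h := congrArg Additive.toMul (hC x y)
    rw [hB, toMul_sub, toMul_ofMul, div_eq_div_iff_mul_eq_mul] at h
    rw [mul_inv_eq_iff_eq_mul, mul_comm, h]

end Existence

/-! ### Passage from the even part to the whole algebra. -/

section Coe

theorem regrade_le {Γ H : Type*} {K : Type v} {A : Type w} [Field K] [Ring A] [Algebra K A]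
    {𝒜 : Γ → Submodule K A} {φ : Γ → H} {γ : Γ} {h : H} (e : φ γ = h) : 𝒜 γ ≤ regrade 𝒜 φ h :=
  e ▸ le_regrade 𝒜 φ γ

variable {K : Type v} {R : Type w} [Field K] [Ring R] [Algebra K R] (𝓡 : ZMod 2 → Submodule K R)
  [GradedAlgebra 𝓡]

theorem isUnit_coe_of_isUnit {a : 𝓡 0} (h : IsUnit a) : IsUnit (a : R) := by
  obtain ⟨u, rfl⟩ := h
  exact ⟨⟨_, _, congrArg Subtype.val u.val_inv, congrArg Subtype.val u.inv_val⟩, rfl⟩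

theorem coe_inverse {a : 𝓡 0} (h : IsUnit a) :
    ((Ring.inverse a : 𝓡 0) : R) = Ring.inverse (a : R) := by
  obtain ⟨u, rfl⟩ := h
  rw [Ring.inverse_unit]
  exact (Ring.inverse_unit ⟨_, _, congrArg Subtype.val u.val_inv,
    congrArg Subtype.val u.inv_val⟩).symm

theorem prod_ofFn_smul {G : Type*} [CommGroup G] [MulAction G R] [IsScalarTower G R R]
    [SMulCommClass G R R] {r : ℕ} (c : Fin r → G) (a : Fin r → R) :
    (List.ofFn fun i => c i • a i).prod = (∏ i, c i) • (List.ofFn a).prod := by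
  induction r with
  | zero => simp
  | succ r ih =>
    rw [List.ofFn_succ, List.prod_cons, List.ofFn_succ, List.prod_cons, ih, smul_mul_smul_comm,
      Fin.prod_univ_succ]

end Coe

/-! ### The map J and invertibility. -/

section GradedJ

variable {Γ : Type u} {K : Type v} {A : Type w} [AddCommGroup Γ] [DecidableEq Γ] [Field K]
  [Ring A] [Algebra K A] {lam : CommutationFactor Γ K} (𝒜 : Γ → Submodule K A) [GradedAlgebra 𝒜]
  (s : NSMultiplier lam) {n : Type*} [Fintype n] [DecidableEq n] {ν : n → Γ} {x y : Γ}
  {X Y : Matrix n n A}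

theorem memMat_one : MemMat 𝒜 ν 0 (1 : Matrix n n A) := (GLZero 𝒜 ν).one_mem

theorem gradedJ_one : gradedJ 𝒜 s ν (1 : Matrix n n A) = 1 := by
  ext i j
  have h := rectJ_apply 𝒜 s (memMat_one 𝒜 (ν := ν)) i j
  by_cases hij : i = j
  · subst hij
    rw [Matrix.one_apply_eq, show (0 : Γ) - ν i + ν i = 0 by abel, s.zero_left, s.zero_right,
      inv_one, one_mul, one_smul] at h
    rw [Matrix.one_apply_eq]
    exact h
  · rw [Matrix.one_apply_ne hij, map_zero, smul_zero] at h
    rw [Matrix.one_apply_ne hij]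
    exact h

theorem gradedJ_mul (hX : MemMat 𝒜 ν x X) (hY : MemMat 𝒜 ν y Y) :
    gradedJ 𝒜 s ν X * gradedJ 𝒜 s ν Y = s x y • gradedJ 𝒜 s ν (X * Y) :=
  rectJ_mul 𝒜 s hX hY

theorem memMat_gradedJ (hX : MemMat 𝒜 ν x X) :
    MemMat (Twist.grading 𝒜 s) ν x (gradedJ 𝒜 s ν X) := by
  intro i j
  have h := rectJ_apply 𝒜 s hX i j
  change rectJ 𝒜 s ν ν X i j ∈ _
  rw [h]
  exact units_smul_mem _ _ (toTwist_mem 𝒜 s (hX i j))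

theorem gradedJ_mul_inverse (hX : MemMat 𝒜 ν x X) (h : IsUnit X) :
    gradedJ 𝒜 s ν X * (s x x • gradedJ 𝒜 s ν (Ring.inverse X)) = 1 := by
  rw [mul_smul_comm, gradedJ_mul 𝒜 s hX (memMat_inverse 𝒜 hX h), Ring.mul_inverse_cancel _ h,
    gradedJ_one, s.neg_right, smul_inv_smul]

theorem gradedJ_inverse_mul (hX : MemMat 𝒜 ν x X) (h : IsUnit X) :
    (s x x • gradedJ 𝒜 s ν (Ring.inverse X)) * gradedJ 𝒜 s ν X = 1 := by
  rw [smul_mul_assoc, gradedJ_mul 𝒜 s (memMat_inverse 𝒜 hX h) hX, Ring.inverse_mul_cancel _ h,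
    gradedJ_one, s.neg_left, smul_inv_smul]

theorem isUnit_gradedJ (hX : MemMat 𝒜 ν x X) (h : IsUnit X) : IsUnit (gradedJ 𝒜 s ν X) :=
  ⟨⟨_, _, gradedJ_mul_inverse 𝒜 s hX h, gradedJ_inverse_mul 𝒜 s hX h⟩, rfl⟩

theorem inverse_gradedJ (hX : MemMat 𝒜 ν x X) (h : IsUnit X) :
    Ring.inverse (gradedJ 𝒜 s ν X) = s x x • gradedJ 𝒜 s ν (Ring.inverse X) :=
  Ring.inverse_unit ⟨_, _, gradedJ_mul_inverse 𝒜 s hX h, gradedJ_inverse_mul 𝒜 s hX h⟩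

theorem gradedJ_injective (hX : MemMat 𝒜 ν x X) (hY : MemMat 𝒜 ν x Y)
    (h : gradedJ 𝒜 s ν X = gradedJ 𝒜 s ν Y) : X = Y := by
  ext i j
  have h1 := rectJ_apply 𝒜 s hX i j
  have h2 := rectJ_apply 𝒜 s hY i j
  have h3 : rectJ 𝒜 s ν ν X i j = rectJ 𝒜 s ν ν Y i j := congrFun (congrFun h i) j
  rw [h1, h2] at h3
  exact (toTwist 𝒜 s).injective (smul_left_cancel _ h3)

theorem exists_gradedJ_eq {V : Matrix n n (Twist 𝒜 s)} (hV : MemMat (Twist.grading 𝒜 s) ν x V) :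
    ∃ W, MemMat 𝒜 ν x W ∧ gradedJ 𝒜 s ν W = V := by
  choose W hW e using hV
  have hm : MemMat 𝒜 ν x
      (Matrix.of fun i j => (s x (ν j) * (s (ν i) (x - ν i + ν j))⁻¹)⁻¹ • W i j) :=
    fun i j => units_smul_mem 𝒜 _ (hW i j)
  refine ⟨_, hm, ?_⟩
  ext i j
  refine (rectJ_apply 𝒜 s hm i j).trans ?_
  rw [Matrix.of_apply, toTwist_units_smul, smul_inv_smul]
  exact e i j

theorem memMat_mul (hX : MemMat 𝒜 ν x X) (hY : MemMat 𝒜 ν y Y) : MemMat 𝒜 ν (x + y) (X * Y) := by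
  intro i j
  rw [Matrix.mul_apply]
  refine sum_mem fun k _ => ?_
  have h := SetLike.GradedMul.mul_mem (hX i k) (hY k j)
  rwa [show x - ν i + ν k + (y - ν k + ν j) = x + y - ν i + ν j by abel] at h

/-- The inverse of J(X) is homogeneous of degree -x, so it is J(W) for some W. Then J(XW) and J(WX)
both equal the scalar s(x,x), and injectivity of J in a fixed degree makes W an inverse of X up to
this scalar. -/
theorem isUnit_of_isUnit_gradedJ (hX : MemMat 𝒜 ν x X) (h : IsUnit (gradedJ 𝒜 s ν X)) :
    IsUnit X := by
  obtain ⟨W, hW, e⟩ := exists_gradedJ_eq 𝒜 s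
    (memMat_inverse (Twist.grading 𝒜 s) (memMat_gradedJ 𝒜 s hX) h)
  have h1 := gradedJ_mul 𝒜 s hX hW
  have h2 := gradedJ_mul 𝒜 s hW hX
  rw [e, Ring.mul_inverse_cancel _ h, s.neg_right, eq_comm, inv_smul_eq_iff] at h1
  rw [e, Ring.inverse_mul_cancel _ h, s.neg_left, eq_comm, inv_smul_eq_iff] at h2
  have m1 : MemMat 𝒜 ν 0 (X * W) := by simpa using memMat_mul 𝒜 hX hW
  have m2 : MemMat 𝒜 ν 0 (W * X) := by simpa using memMat_mul 𝒜 hW hX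
  have m : MemMat 𝒜 ν 0 (s x x • (1 : Matrix n n A)) :=
    fun i j => units_smul_mem 𝒜 _ (memMat_one 𝒜 i j)
  have e1 : gradedJ 𝒜 s ν (s x x • (1 : Matrix n n A)) = s x x • 1 := by
    rw [← gradedJ_one 𝒜 s (ν := ν)]
    ext i j
    simp [gradedJ, Units.smul_def]
  have f1 : X * W = s x x • 1 := gradedJ_injective 𝒜 s m1 m (h1.trans e1.symm)
  have f2 : W * X = s x x • 1 := gradedJ_injective 𝒜 s m2 m (h2.trans e1.symm)
  refine ⟨⟨X, (s x x)⁻¹ • W, ?_, ?_⟩, rfl⟩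
  · rw [mul_smul_comm, f1, inv_smul_smul]
  · rw [smul_mul_assoc, f2, inv_smul_smul]

end GradedJ

/-! ### Blocks and Schur complements under J. -/

section Blocks

variable {Γ : Type u} {K : Type v} {A : Type w} [AddCommGroup Γ] [DecidableEq Γ] [Field K]
  [Ring A] [Algebra K A] {lam : CommutationFactor Γ K} (𝒜 : Γ → Submodule K A) [GradedAlgebra 𝒜]
  (s : NSMultiplier lam) {m n : Type*} [Fintype m] [DecidableEq m] [Fintype n] [DecidableEq n]
  {ν₀ : m → Γ} {ν₁ : n → Γ} {x : Γ} {X : Matrix (m ⊕ n) (m ⊕ n) A}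

theorem memMat_schur (hX : MemMat 𝒜 (Sum.elim ν₀ ν₁) x X) (h : IsUnit X.toBlocks₂₂) :
    MemMat 𝒜 ν₀ x (schur X) := by
  intro i j
  refine sub_mem (hX (Sum.inl i) (Sum.inl j)) ?_
  rw [Matrix.mul_apply]
  refine sum_mem fun k _ => ?_
  rw [Matrix.mul_apply, Finset.sum_mul]
  refine sum_mem fun k' _ => ?_
  have h1 := memMat_inverse 𝒜 (ν := ν₁) (fun i j => hX (Sum.inr i) (Sum.inr j)) h k' k
  have h2 := SetLike.GradedMul.mul_mem (SetLike.GradedMul.mul_mem (hX (Sum.inl i) (Sum.inr k')) h1)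
    (hX (Sum.inr k) (Sum.inl j))
  simp only [Sum.elim_inl, Sum.elim_inr] at h2
  rwa [show x - ν₀ i + ν₁ k' + (-x - ν₁ k' + ν₁ k) + (x - ν₁ k + ν₀ j) = x - ν₀ i + ν₀ j by abel]
    at h2

/-- The inverse of the J-image of the lower right block contributes s(x,x), which cancels the
s(x,-x) from multiplying by the upper right block. That product has degree 0, so multiplying by the
lower left block costs nothing. -/
theorem schur_gradedJ (hX : MemMat 𝒜 (Sum.elim ν₀ ν₁) x X) (h : IsUnit X.toBlocks₂₂) :
    schur (gradedJ 𝒜 s (Sum.elim ν₀ ν₁) X) = gradedJ 𝒜 s ν₀ (schur X) := by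
  have h01 : ∀ i j, X.toBlocks₁₂ i j ∈ 𝒜 (x - ν₀ i + ν₁ j) :=
    fun i j => hX (Sum.inl i) (Sum.inr j)
  have h10 : ∀ i j, X.toBlocks₂₁ i j ∈ 𝒜 (x - ν₁ i + ν₀ j) :=
    fun i j => hX (Sum.inr i) (Sum.inl j)
  have h11 : MemMat 𝒜 ν₁ x X.toBlocks₂₂ := fun i j => hX (Sum.inr i) (Sum.inr j)
  have hinv := memMat_inverse 𝒜 h11 h
  have hp : ∀ i j, (X.toBlocks₁₂ * Ring.inverse X.toBlocks₂₂) i j ∈ 𝒜 (0 - ν₀ i + ν₁ j) := by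
    intro i j
    rw [Matrix.mul_apply]
    refine sum_mem fun k _ => ?_
    have h2 := SetLike.GradedMul.mul_mem (h01 i k) (hinv k j)
    rwa [show x - ν₀ i + ν₁ k + (-x - ν₁ k + ν₁ j) = 0 - ν₀ i + ν₁ j by abel] at h2
  have e1 := rectJ_mul 𝒜 s h01 hinv
  have e2 := rectJ_mul 𝒜 s hp h10
  rw [s.zero_left, one_smul] at e2
  change rectJ 𝒜 s ν₀ ν₀ X.toBlocks₁₁ - rectJ 𝒜 s ν₀ ν₁ X.toBlocks₁₂ *
    Ring.inverse (gradedJ 𝒜 s ν₁ X.toBlocks₂₂) * rectJ 𝒜 s ν₁ ν₀ X.toBlocks₂₁ =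
    rectJ 𝒜 s ν₀ ν₀ (schur X)
  rw [schur, rectJ_sub, ← e2, inverse_gradedJ 𝒜 s h11 h, Matrix.mul_smul]
  have e : gradedJ 𝒜 s ν₁ (Ring.inverse X.toBlocks₂₂) =
      rectJ 𝒜 s ν₁ ν₁ (Ring.inverse X.toBlocks₂₂) := rfl
  rw [e, e1, s.neg_right, smul_inv_smul]

theorem memSuperGL_gradedJ (hν₀ : ∀ i, lam.parity (ν₀ i) = 0) (hν₁ : ∀ i, lam.parity (ν₁ i) = 1)
    (hx : lam.parity x = 0) (hX : MemGL 𝒜 (Sum.elim ν₀ ν₁) x X) :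
    MemSuperGL (Twist.superGrading 𝒜 s) (gradedJ 𝒜 s (Sum.elim ν₀ ν₁) X) := by
  refine ⟨isUnit_gradedJ 𝒜 s hX.2 hX.1, fun i j => ?_⟩
  have hp : ∀ k, lam.parity (Sum.elim ν₀ ν₁ k) = superDegree k := by
    rintro (k | k)
    · exact hν₀ k
    · exact hν₁ k
  refine regrade_le ?_ (memMat_gradedJ 𝒜 s hX.2 i j)
  rw [map_add, map_sub, hx, hp, hp]

end Blocks

/-! ### Graded determinants. -/

section Gdet

/-- The Leibniz formula with ordered products, which make sense in the noncommutative algebra and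
can be compared with products before twisting. -/
theorem evenDet_apply {K : Type v} {R : Type w} [Field K] [Ring R] [Algebra K R]
    (𝓡 : ZMod 2 → Submodule K R) [GradedAlgebra 𝓡] [IsColorCommutative (superSign K) 𝓡] {r : ℕ}
    {M : Matrix (Fin r) (Fin r) R} (hM : ∀ i j, M i j ∈ 𝓡 0) :
    (evenDet 𝓡 M : R) =
      ∑ σ : Equiv.Perm (Fin r), Equiv.Perm.sign σ • (List.ofFn fun i => M (σ i) i).prod := by
  let _ := evenCommRing 𝓡
  let φ : 𝓡 0 →+* R :=
    { toFun := Subtype.val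
      map_one' := rfl
      map_mul' := fun _ _ => rfl
      map_zero' := rfl
      map_add' := fun _ _ => rfl }
  obtain ⟨N, rfl⟩ := exists_evenMap 𝓡 hM
  rw [evenDet_evenMap]
  change φ (Matrix.det N) = _
  rw [Matrix.det_apply, map_sum]
  refine Finset.sum_congr rfl fun σ _ => ?_
  rw [Units.smul_def, Units.smul_def, map_zsmul, ← List.prod_ofFn, map_list_prod, List.map_ofFn]
  rfl

variable {Γ : Type u} {K : Type v} {A : Type w} [AddCommGroup Γ] [DecidableEq Γ] [Field K]
  [Ring A] [Algebra K A] {lam : CommutationFactor Γ K} (𝒜 : Γ → Submodule K A) [GradedAlgebra 𝒜]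
  [IsColorCommutative lam 𝒜] (s s' : NSMultiplier lam) {r : ℕ} {ν : Fin r → Γ} {x : Γ}
  {X : Matrix (Fin r) (Fin r) A}

theorem gradedJ_even (hν : ∀ i j, lam.parity (ν i) = lam.parity (ν j)) (hx : lam.parity x = 0)
    (hX : MemMat 𝒜 ν x X) (i j : Fin r) :
    gradedJ 𝒜 s ν X i j ∈ Twist.superGrading 𝒜 s 0 := by
  refine regrade_le ?_ (memMat_gradedJ 𝒜 s hX i j)
  rw [map_add, map_sub, hx, hν i j, sub_add_cancel]

theorem gdet_apply (hν : ∀ i j, lam.parity (ν i) = lam.parity (ν j)) (hx : lam.parity x = 0)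
    (hX : MemMat 𝒜 ν x X) : gdet 𝒜 s ν X = ∑ σ : Equiv.Perm (Fin r), Equiv.Perm.sign σ •
      s.detCoeff ν x σ • (List.ofFn fun i => X (σ i) i).prod := by
  rw [gdet, evenDet_apply _ (gradedJ_even 𝒜 s hν hx hX), map_sum]
  refine Finset.sum_congr rfl fun σ _ => ?_
  rw [Units.smul_def, Units.smul_def, map_zsmul]
  congr 1
  rw [LinearEquiv.symm_apply_eq, toTwist_units_smul]
  have h : ∀ i, gradedJ 𝒜 s ν X (σ i) i = toTwist 𝒜 s
      ((s x (ν i) * (s (ν (σ i)) (x - ν (σ i) + ν i))⁻¹) • X (σ i) i) :=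
    fun i => rectJ_apply 𝒜 s hX (σ i) i
  have e := prod_ofFn_smul (fun i => s x (ν i) * (s (ν (σ i)) (x - ν (σ i) + ν i))⁻¹)
    fun i => X (σ i) i
  simp only [h]
  rw [prod_ofFn_toTwist 𝒜 s (γ := fun i => x - ν (σ i) + ν i)
    fun i => units_smul_mem 𝒜 _ (hX (σ i) i), e, toTwist_units_smul, smul_smul]
  rfl

/-- The weights cancel along each permutation, so each term of the Leibniz formula has degree r x.
-/
theorem gdet_mem (hν : ∀ i j, lam.parity (ν i) = lam.parity (ν j)) (hx : lam.parity x = 0)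
    (hX : MemMat 𝒜 ν x X) : gdet 𝒜 s ν X ∈ 𝒜 (r • x) := by
  rw [gdet_apply 𝒜 s hν hx hX]
  refine sum_mem fun σ _ => ?_
  rw [Units.smul_def]
  refine zsmul_mem (units_smul_mem 𝒜 _ ?_) _
  have h := prod_ofFn_mem 𝒜 fun i => hX (σ i) i
  rwa [Finset.sum_add_distrib, Finset.sum_sub_distrib, Equiv.sum_comp σ ν, sub_add_cancel,
    Finset.sum_const, Finset.card_univ, Fintype.card_fin] at h

theorem gdet_zero_eq (hν : ∀ i j, lam.parity (ν i) = lam.parity (ν j)) (hX : MemMat 𝒜 ν 0 X) :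
    gdet 𝒜 s ν X = gdet 𝒜 s' ν X := by
  rw [gdet_apply 𝒜 s hν (map_zero _) hX, gdet_apply 𝒜 s' hν (map_zero _) hX]
  refine Finset.sum_congr rfl fun σ _ => ?_
  rw [NSMultiplier.detCoeff_zero s s']

theorem toTwist_gdet : toTwist 𝒜 s (gdet 𝒜 s ν X) =
    (evenDet (Twist.superGrading 𝒜 s) (gradedJ 𝒜 s ν X) : Twist 𝒜 s) := rfl

theorem isUnit_gdet (hν : ∀ i j, lam.parity (ν i) = lam.parity (ν j)) (hx : lam.parity x = 0)
    (hX : MemGL 𝒜 ν x X) : IsUnit (gdet 𝒜 s ν X) := by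
  refine isUnit_of_isUnit_toTwist 𝒜 s (gdet_mem 𝒜 s hν hx hX.2) ?_
  exact isUnit_coe_of_isUnit _ (isUnit_evenDet _ (gradedJ_even 𝒜 s hν hx hX.2)
    (isUnit_gradedJ 𝒜 s hX.2 hX.1))

end Gdet

/-! ### Graded Berezinians. -/

section Gber

variable {Γ : Type u} {K : Type v} {A : Type w} [AddCommGroup Γ] [DecidableEq Γ] [Field K]
  [CharZero K] [Ring A] [Algebra K A] {lam : CommutationFactor Γ K} {𝒜 : Γ → Submodule K A}
  [GradedAlgebra 𝒜] [IsColorCommutative lam 𝒜] (s s' : NSMultiplier lam) {r₀ r₁ : ℕ}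
  {ν₀ : Fin r₀ → Γ} {ν₁ : Fin r₁ → Γ} {x : Γ}
  {X : Matrix (Fin r₀ ⊕ Fin r₁) (Fin r₀ ⊕ Fin r₁) A}
  (hν₀ : ∀ i, lam.parity (ν₀ i) = 0) (hν₁ : ∀ i, lam.parity (ν₁ i) = 1)
  (hx : lam.parity x = 0) (hX : MemGL 𝒜 (Sum.elim ν₀ ν₁) x X)
include s hν₀ hν₁ hx hX

/-- Although the conclusion does not involve s, invertibility is read off the supermatrix J(X) and
transported back. -/
theorem memGL_toBlocks₂₂ : MemGL 𝒜 ν₁ x X.toBlocks₂₂ := by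
  have h : MemMat 𝒜 ν₁ x X.toBlocks₂₂ := fun i j => hX.2 (Sum.inr i) (Sum.inr j)
  exact ⟨isUnit_of_isUnit_gradedJ 𝒜 s h
    (memSuperGL_gradedJ 𝒜 s hν₀ hν₁ hx hX).isUnit_toBlocks₂₂, h⟩

theorem memGL_schur : MemGL 𝒜 ν₀ x (schur X) := by
  have h := (memGL_toBlocks₂₂ s hν₀ hν₁ hx hX).1
  exact ⟨isUnit_schur hX.1 h, memMat_schur 𝒜 hX.2 h⟩

theorem toTwist_gber : toTwist 𝒜 s (gber 𝒜 s ν₀ ν₁ X) = toTwist 𝒜 s (gdet 𝒜 s ν₀ (schur X)) *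
    Ring.inverse (toTwist 𝒜 s (gdet 𝒜 s ν₁ X.toBlocks₂₂)) := by
  have hu := memGL_toBlocks₂₂ s hν₀ hν₁ hx hX
  have hs := memSuperGL_gradedJ 𝒜 s hν₀ hν₁ hx hX
  rw [toTwist_gdet, toTwist_gdet, ← schur_gradedJ 𝒜 s hX.2 hu.1]
  exact congrArg (fun z => (evenDet (Twist.superGrading 𝒜 s)
    (schur (gradedJ 𝒜 s (Sum.elim ν₀ ν₁) X)) : Twist 𝒜 s) * z) (coe_inverse (Twist.superGrading 𝒜 s)
    (isUnit_evenDet _ hs.even₂₂ hs.isUnit_toBlocks₂₂))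

/-- The graded determinants have degrees r₀x and r₁x. Inverting the second contributes s(r₁x, r₁x)
and the product contributes s(r₀x, -r₁x), for a total exponent r₁² - r₀r₁. -/
theorem gber_eq : gber 𝒜 s ν₀ ν₁ X = (s x x ^ (-((r₁ : ℤ) * ((r₀ : ℤ) - (r₁ : ℤ))))) •
    (gdet 𝒜 s ν₀ (schur X) * Ring.inverse (gdet 𝒜 s ν₁ X.toBlocks₂₂)) := by
  have h₀ : ∀ i j, lam.parity (ν₀ i) = lam.parity (ν₀ j) := fun i j => by rw [hν₀, hν₀]
  have h₁ : ∀ i j, lam.parity (ν₁ i) = lam.parity (ν₁ j) := fun i j => by rw [hν₁, hν₁]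
  have hb := memGL_toBlocks₂₂ s hν₀ hν₁ hx hX
  have ha := memGL_schur s hν₀ hν₁ hx hX
  have ma := gdet_mem 𝒜 s h₀ hx ha.2
  have mb := gdet_mem 𝒜 s h₁ hx hb.2
  have ub := isUnit_gdet 𝒜 s h₁ hx hb
  refine (toTwist 𝒜 s).injective ?_
  rw [toTwist_gber s hν₀ hν₁ hx hX, inverse_toTwist 𝒜 s mb ub, mul_smul_comm,
    toTwist_mul_toTwist 𝒜 s ma (inverse_mem 𝒜 mb ub), smul_smul, toTwist_units_smul]
  congr 1
  simp only [s.neg_right, s.nsmul_left, s.nsmul_right, ← zpow_natCast, ← zpow_mul, ← zpow_neg,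
    ← zpow_add]
  congr 1
  ring

theorem isUnit_gber : IsUnit (gber 𝒜 s ν₀ ν₁ X) := by
  have h₀ : ∀ i j, lam.parity (ν₀ i) = lam.parity (ν₀ j) := fun i j => by rw [hν₀, hν₀]
  have h₁ : ∀ i j, lam.parity (ν₁ i) = lam.parity (ν₁ j) := fun i j => by rw [hν₁, hν₁]
  rw [gber_eq s hν₀ hν₁ hx hX]
  exact ((isUnit_gdet 𝒜 s h₀ hx (memGL_schur s hν₀ hν₁ hx hX)).mul
    (isUnit_gdet 𝒜 s h₁ hx (memGL_toBlocks₂₂ s hν₀ hν₁ hx hX)).ringInverse).smul _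

omit hx hX in
theorem gber_zero_eq (hX : MemGL 𝒜 (Sum.elim ν₀ ν₁) 0 X) :
    gber 𝒜 s ν₀ ν₁ X = gber 𝒜 s' ν₀ ν₁ X := by
  have h₀ : ∀ i j, lam.parity (ν₀ i) = lam.parity (ν₀ j) := fun i j => by rw [hν₀, hν₀]
  have h₁ : ∀ i j, lam.parity (ν₁ i) = lam.parity (ν₁ j) := fun i j => by rw [hν₁, hν₁]
  have h0 := map_zero lam.parity
  rw [gber_eq s hν₀ hν₁ h0 hX, gber_eq s' hν₀ hν₁ h0 hX, s.zero_left, s'.zero_left,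
    gdet_zero_eq 𝒜 s s' h₀ (memGL_schur s hν₀ hν₁ h0 hX).2,
    gdet_zero_eq 𝒜 s s' h₁ (memGL_toBlocks₂₂ s hν₀ hν₁ h0 hX).2]

omit hx hX in
theorem gber_zero_mem (hX : MemGL 𝒜 (Sum.elim ν₀ ν₁) 0 X) : gber 𝒜 s ν₀ ν₁ X ∈ 𝒜 0 := by
  have h₀ : ∀ i j, lam.parity (ν₀ i) = lam.parity (ν₀ j) := fun i j => by rw [hν₀, hν₀]
  have h₁ : ∀ i j, lam.parity (ν₁ i) = lam.parity (ν₁ j) := fun i j => by rw [hν₁, hν₁]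
  have h0 := map_zero lam.parity
  have hb := memGL_toBlocks₂₂ s hν₀ hν₁ h0 hX
  have ma := gdet_mem 𝒜 s h₀ h0 (memGL_schur s hν₀ hν₁ h0 hX).2
  have mb := inverse_mem 𝒜 (gdet_mem 𝒜 s h₁ h0 hb.2) (isUnit_gdet 𝒜 s h₁ h0 hb)
  rw [gber_eq s hν₀ hν₁ h0 hX]
  have h := units_smul_mem 𝒜 (s 0 0 ^ (-((r₁ : ℤ) * ((r₀ : ℤ) - (r₁ : ℤ)))))
    (SetLike.GradedMul.mul_mem ma mb)
  rwa [smul_zero, smul_zero, neg_zero, add_zero] at h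

omit hx hX in
-- Both J on matrices of degree 0 and the passage to the twisted product on elements of degree 0 are
-- free of scalars, so multiplicativity of `ber` carries over.
theorem gber_zero_mul {Y : Matrix (Fin r₀ ⊕ Fin r₁) (Fin r₀ ⊕ Fin r₁) A}
    (hX : MemGL 𝒜 (Sum.elim ν₀ ν₁) 0 X) (hY : MemGL 𝒜 (Sum.elim ν₀ ν₁) 0 Y) :
    gber 𝒜 s ν₀ ν₁ (X * Y) = gber 𝒜 s ν₀ ν₁ X * gber 𝒜 s ν₀ ν₁ Y := by
  have h0 := map_zero lam.parity
  have hJ := gradedJ_mul 𝒜 s hX.2 hY.2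
  rw [s.zero_left, one_smul] at hJ
  have hb := (memSuperGL_gradedJ 𝒜 s hν₀ hν₁ h0 hX).ber_mul (memSuperGL_gradedJ 𝒜 s hν₀ hν₁ h0 hY)
  have hm := toTwist_mul_toTwist 𝒜 s (gber_zero_mem s hν₀ hν₁ hX) (gber_zero_mem s hν₀ hν₁ hY)
  rw [s.zero_left, one_smul] at hm
  refine (toTwist 𝒜 s).injective (Eq.trans ?_ hm)
  rw [hJ] at hb
  exact congrArg Subtype.val hb

end Gber

end

end Color

open Color

theorem theoremE {Γ K A : Type*} [AddCommGroup Γ] [AddGroup.FG Γ] [DecidableEq Γ]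
    [Field K] [CharZero K] [Ring A] [Algebra K A]
    (lam : CommutationFactor Γ K) (𝒜 : Γ → Submodule K A) [GradedAlgebra 𝒜]
    [IsColorCommutative lam 𝒜]
    (r₀ r₁ : ℕ) (ν₀ : Fin r₀ → Γ) (ν₁ : Fin r₁ → Γ)
    (hν₀ : ∀ i, lam.parity (ν₀ i) = 0) (hν₁ : ∀ i, lam.parity (ν₁ i) = 1) :
    (∃ gberZero : GLZero 𝒜 (Sum.elim ν₀ ν₁) →* Aˣ,
      ∀ (s : NSMultiplier lam) (X : GLZero 𝒜 (Sum.elim ν₀ ν₁)),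
        gber 𝒜 s ν₀ ν₁ ((X : (Matrix (Fin r₀ ⊕ Fin r₁) (Fin r₀ ⊕ Fin r₁) A)ˣ) :
          Matrix (Fin r₀ ⊕ Fin r₁) (Fin r₀ ⊕ Fin r₁) A) = (gberZero X : A)) ∧
    (∀ (s : NSMultiplier lam) (x : Γ), lam.parity x = 0 →
      ∀ X : Matrix (Fin r₀ ⊕ Fin r₁) (Fin r₀ ⊕ Fin r₁) A, MemGL 𝒜 (Sum.elim ν₀ ν₁) x X →
        MemSuperGL (Twist.superGrading 𝒜 s) (gradedJ 𝒜 s (Sum.elim ν₀ ν₁) X) ∧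
        IsUnit (gber 𝒜 s ν₀ ν₁ X) ∧
        gber 𝒜 s ν₀ ν₁ X ∈ regrade 𝒜 lam.parity 0 ∧
        MemGL 𝒜 ν₁ x X.toBlocks₂₂ ∧
        MemGL 𝒜 ν₀ x (X.toBlocks₁₁ - X.toBlocks₁₂ * Ring.inverse X.toBlocks₂₂ * X.toBlocks₂₁) ∧
        IsUnit (gdet 𝒜 s ν₁ X.toBlocks₂₂) ∧
        gber 𝒜 s ν₀ ν₁ X =
          (s x x ^ (-((r₁ : ℤ) * ((r₀ : ℤ) - (r₁ : ℤ))))) •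
            (gdet 𝒜 s ν₀
                (X.toBlocks₁₁ - X.toBlocks₁₂ * Ring.inverse X.toBlocks₂₂ * X.toBlocks₂₁) *
              Ring.inverse (gdet 𝒜 s ν₁ X.toBlocks₂₂))) := by
  constructor
  · have hGL : ∀ X : GLZero 𝒜 (Sum.elim ν₀ ν₁), MemGL 𝒜 (Sum.elim ν₀ ν₁) 0
        ((X : (Matrix (Fin r₀ ⊕ Fin r₁) (Fin r₀ ⊕ Fin r₁) A)ˣ) :
          Matrix (Fin r₀ ⊕ Fin r₁) (Fin r₀ ⊕ Fin r₁) A) := fun X => ⟨X.1.isUnit, X.2⟩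
    -- One fixed multiplier defines the morphism, and `gber_zero_eq` identifies it with the map of
    -- every other multiplier.
    obtain ⟨s⟩ := NSMultiplier.nonempty lam
    refine ⟨MonoidHom.mk' (fun X => (isUnit_gber s hν₀ hν₁ (map_zero _) (hGL X)).unit)
      fun X Y => Units.ext ?_, fun s' X => gber_zero_eq s' s hν₀ hν₁ (hGL X)⟩
    exact gber_zero_mul s hν₀ hν₁ (hGL X) (hGL Y)
  · intro s x hx X hX
    exact ⟨memSuperGL_gradedJ 𝒜 s hν₀ hν₁ hx hX, isUnit_gber s hν₀ hν₁ hx hX,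
      mem_regrade_of_superGrading 𝒜 s
        (ber (Twist.superGrading 𝒜 s) (gradedJ 𝒜 s (Sum.elim ν₀ ν₁) X)).2,
      memGL_toBlocks₂₂ s hν₀ hν₁ hx hX, memGL_schur s hν₀ hν₁ hx hX,
      isUnit_gdet 𝒜 s (fun i j => by rw [hν₁, hν₁]) hx (memGL_toBlocks₂₂ s hν₀ hν₁ hx hX),
      gber_eq s hν₀ hν₁ hx hX⟩
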